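/- Let $M$ be a closed (compact, without boundary) smooth $n$-manifold and let $f:M\to M$ be a $C^\infty$ Morse–Smale diffeomorphism, i.e. its nonwandering set is $\Omega(f)=\mathrm{Per}(f)$, which consists of finitely many hyperbolic periodic points, and the invariant manifolds $W^u(p)$ and $W^s(q)$ intersect transversally for all $p,q\in\mathrm{Per}(f)$. Here, for a periodic point $p$ of period $k_p$, $W^s(p)=\{x: f^{mk_p}(x)\to p \text{ as } m\to+\infty\}$ and $W^u(p)=\{x: f^{mk_p}(x)\to p\text{ as } m\to-\infty\}$. A Lyapunov function for $f$ is a $C^\infty$ Morse function $\varphi:M\to\mathbb R$ (all its critical points are non-degenerate) such that $\varphi(f(x))<\varphi(x)$ if $x\notin \mathrm{Per}(f)$ and $\varphi(f(x))=\varphi(x)$ if $x\in \mathrm{Per}(f)$. It is called a Morse–Lyapunov function if every periodic point $p$ is a non-degenerate maximum of $\varphi|_{W^u(p)}$ and a non-degenerate minimum of $\varphi|_{W^s(p)}$. Then, in the space of all Lyapunov functions for $f$, equipped with the subspace topology of the $C^\infty$-topology on $C^\infty(M,\mathbb R)$, the Morse–Lyapunov functions form an open and dense subset; in particular they form a residual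 subset (one containing a countable intersection of open dense subsets). -/

import Mathlib

open Set Filter Topology Function
open scoped Manifold ContDiff

noncomputable section

namespace MorseLyapunov

variable {n : ℕ} {M : Type*} [TopologicalSpace M] [ChartedSpace (EuclideanSpace ℝ (Fin n)) M]

/-! ### The dynamics: Morse-Smale diffeomorphisms -/

/-- The nonwandering set `Ω(f)`: the points all of whose neighbourhoods meet one of their
images under a positive iterate of `f`. -/
def nonwanderingSet (f : M → M) : Set M :=
  {x | ∀ U ∈ 𝓝 x, ∃ m : ℕ, 1 ≤ m ∧ ((f^[m] '' U) ∩ U).Nonempty}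

/-- The differential `T_p M → T_p M` at the periodic point `p` of `f^k`, where `k` is the period
of `p`, read in the preferred chart at `p`. -/
def returnDeriv (f : M ≃ₘ^∞⟮𝓡 n, 𝓡 n⟯ M) (p : M) :
    EuclideanSpace ℝ (Fin n) →L[ℝ] EuclideanSpace ℝ (Fin n) :=
  mfderiv (𝓡 n) (𝓡 n) (f^[minimalPeriod f p]) p

/-- The periodic point `p` is hyperbolic: `T_p M` is a direct sum of two subspaces invariant under
the return differential, which is exponentially contracting on the first one and exponentially
expanding on the second one. -/
def IsHyperbolicAt (f : M ≃ₘ^∞⟮𝓡 n, 𝓡 n⟯ M) (p : M) : Prop :=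
  ∃ Es Eu : Submodule ℝ (EuclideanSpace ℝ (Fin n)), IsCompl Es Eu ∧
    (∀ v ∈ Es, returnDeriv f p v ∈ Es) ∧ (∀ v ∈ Eu, returnDeriv f p v ∈ Eu) ∧
    ∃ C r : ℝ, 0 < C ∧ 0 < r ∧ r < 1 ∧
      (∀ v ∈ Es, ∀ m : ℕ, ‖(returnDeriv f p ^ m) v‖ ≤ C * r ^ m * ‖v‖) ∧
      (∀ v ∈ Eu, ∀ m : ℕ, ‖v‖ ≤ C * r ^ m * ‖(returnDeriv f p ^ m) v‖)

/-- The stable manifold `W^s(p) = {x | f^(m k_p) (x) → p as m → +∞}` of a periodic point `p` of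
period `k_p`. -/
def stableManifold (f : M ≃ₘ^∞⟮𝓡 n, 𝓡 n⟯ M) (p : M) : Set M :=
  {x | Tendsto (fun m : ℕ => f^[m * minimalPeriod f p] x) atTop (𝓝 p)}

/-- The unstable manifold `W^u(p) = {x | f^(m k_p) (x) → p as m → -∞}`, that is, the stable
manifold of `p` for the inverse diffeomorphism (for which `p` has the same period). -/
def unstableManifold (f : M ≃ₘ^∞⟮𝓡 n, 𝓡 n⟯ M) (p : M) : Set M :=
  stableManifold f.symm p

/-- Smooth curves in the immersed submanifold `W^s(p)`. The last condition says that the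
convergence `f^(m k_p) (γ t) → p` is locally uniform in `t`: since `W^s(p)` is the increasing union
of the preimages under `f^(m k_p)` of a small embedded disc around `p`, this is continuity of the
curve for the manifold topology of `W^s(p)`, which may be finer than the subspace topology. -/
structure IsStableCurve (f : M ≃ₘ^∞⟮𝓡 n, 𝓡 n⟯ M) (p : M) (γ : ℝ → M) : Prop where
  smooth : ContMDiff 𝓘(ℝ, ℝ) (𝓡 n) ∞ γ
  mem : ∀ t, γ t ∈ stableManifold f p
  locallyUniform : ∀ t, Tendsto (fun q : ℕ × ℝ => f^[q.1 * minimalPeriod f p] (γ q.2))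
    (atTop ×ˢ 𝓝 t) (𝓝 p)

/-- The velocity `γ'(0)`, an element of `T_{γ 0} M` (read in the preferred chart at `γ 0`). -/
def velocity (γ : ℝ → M) : EuclideanSpace ℝ (Fin n) :=
  mfderiv 𝓘(ℝ, ℝ) (𝓡 n) γ 0 (1 : ℝ)

/-- The tangent space at `x` of the stable manifold `W^s(p)`: the velocities at `x` of the smooth
curves in `W^s(p)` through `x`. -/
def stableTangent (f : M ≃ₘ^∞⟮𝓡 n, 𝓡 n⟯ M) (p x : M) : Set (EuclideanSpace ℝ (Fin n)) :=
  {v | ∃ γ : ℝ → M, IsStableCurve f p γ ∧ γ 0 = x ∧ velocity γ = v}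

/-- The tangent space at `x` of the unstable manifold `W^u(p)`. -/
def unstableTangent (f : M ≃ₘ^∞⟮𝓡 n, 𝓡 n⟯ M) (p x : M) : Set (EuclideanSpace ℝ (Fin n)) :=
  stableTangent f.symm p x

/-- Morse-Smale diffeomorphisms: the nonwandering set consists of finitely many hyperbolic periodic
points, and stable and unstable manifolds of periodic points intersect transversally, that is,
`T_x W^u(p) + T_x W^s(q) = T_x M` at each point `x` of `W^u(p) ∩ W^s(q)`. -/
structure IsMorseSmale (f : M ≃ₘ^∞⟮𝓡 n, 𝓡 n⟯ M) : Prop where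
  finite : (nonwanderingSet f).Finite
  nonwandering_eq : nonwanderingSet f = periodicPts f
  hyperbolic : ∀ p ∈ periodicPts f, IsHyperbolicAt f p
  transversal : ∀ p ∈ periodicPts f, ∀ q ∈ periodicPts f,
    ∀ x ∈ unstableManifold f p ∩ stableManifold f q, ∀ w : EuclideanSpace ℝ (Fin n),
      ∃ u ∈ unstableTangent f p x, ∃ v ∈ stableTangent f q x, u + v = w

/-! ### Morse, Lyapunov and Morse-Lyapunov functions -/

/-- The Hessian of `φ` at `x` in the preferred chart at `x` (intrinsic if `x` is critical). -/
def chartHessian (φ : M → ℝ) (x : M) :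
    EuclideanSpace ℝ (Fin n) →L[ℝ] EuclideanSpace ℝ (Fin n) →L[ℝ] ℝ :=
  fderiv ℝ (fderiv ℝ (φ ∘ (extChartAt (𝓡 n) x).symm)) (extChartAt (𝓡 n) x x)

/-- Morse functions: every critical point is non-degenerate. -/
def IsMorse (φ : C^∞⟮𝓡 n, M; 𝓘(ℝ, ℝ), ℝ⟯) : Prop :=
  ∀ x : M, mfderiv (𝓡 n) 𝓘(ℝ, ℝ) φ x = 0 →
    ∀ v : EuclideanSpace ℝ (Fin n), (∀ w, chartHessian φ x v w = 0) → v = 0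

/-- Lyapunov functions of a diffeomorphism: Morse functions that decrease strictly along the
non-periodic orbits and are constant along the periodic ones. -/
structure IsLyapunov (f : M ≃ₘ^∞⟮𝓡 n, 𝓡 n⟯ M) (φ : C^∞⟮𝓡 n, M; 𝓘(ℝ, ℝ), ℝ⟯) : Prop where
  morse : IsMorse φ
  decreasing : ∀ x, x ∉ periodicPts f → φ (f x) < φ x
  const : ∀ x ∈ periodicPts f, φ (f x) = φ x

/-- The point `p` is a non-degenerate minimum of the restriction of `φ` to `W^s(p)`: it is a
minimum, and the Hessian at `p` of the restriction, whose value at `γ'(0)` is `(φ ∘ γ)''(0)` for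
each smooth curve `γ` in `W^s(p)` through `p`, is positive on the non-zero vectors (for a positive
semi-definite form this is non-degeneracy). -/
def IsNondegMinOnStable (f : M ≃ₘ^∞⟮𝓡 n, 𝓡 n⟯ M) (φ : M → ℝ) (p : M) : Prop :=
  IsMinOn φ (stableManifold f p) p ∧
    ∀ γ : ℝ → M, IsStableCurve f p γ → γ 0 = p → velocity (n := n) γ ≠ 0 →
      0 < iteratedDeriv 2 (φ ∘ γ) 0

/-- The point `p` is a non-degenerate maximum of the restriction of `φ` to `W^u(p)`: it is a
maximum, and the Hessian at `p` of the restriction is negative definite. -/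
def IsNondegMaxOnUnstable (f : M ≃ₘ^∞⟮𝓡 n, 𝓡 n⟯ M) (φ : M → ℝ) (p : M) : Prop :=
  IsMaxOn φ (unstableManifold f p) p ∧
    ∀ γ : ℝ → M, IsStableCurve f.symm p γ → γ 0 = p → velocity (n := n) γ ≠ 0 →
      iteratedDeriv 2 (φ ∘ γ) 0 < 0

/-- Morse-Lyapunov functions. -/
structure IsMorseLyapunov (f : M ≃ₘ^∞⟮𝓡 n, 𝓡 n⟯ M) (φ : C^∞⟮𝓡 n, M; 𝓘(ℝ, ℝ), ℝ⟯) : Prop where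
  lyapunov : IsLyapunov f φ
  nondegMax : ∀ p ∈ periodicPts f, IsNondegMaxOnUnstable f φ p
  nondegMin : ∀ p ∈ periodicPts f, IsNondegMinOnStable f φ p

/-! ### The topology -/

/-- The `C^∞` topology on the smooth functions on a (compact) manifold: uniform convergence of all
partial derivatives, in all smooth charts, on the compact subsets of the chart domain. -/
instance smoothTopology : TopologicalSpace C^∞⟮𝓡 n, M; 𝓘(ℝ, ℝ), ℝ⟯ :=
  ⨅ (e ∈ IsManifold.maximalAtlas (𝓡 n) ∞ M) (i : ℕ),
    TopologicalSpace.induced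
      (fun φ : C^∞⟮𝓡 n, M; 𝓘(ℝ, ℝ), ℝ⟯ =>
        UniformOnFun.ofFun {K | IsCompact K ∧ K ⊆ e.target} (iteratedFDeriv ℝ i (φ ∘ e.symm)))
      inferInstance

/-- The space of Lyapunov functions of `f`, with the subspace topology. -/
abbrev LyapunovFunction (f : M ≃ₘ^∞⟮𝓡 n, 𝓡 n⟯ M) : Type _ :=
  {φ : C^∞⟮𝓡 n, M; 𝓘(ℝ, ℝ), ℝ⟯ // IsLyapunov f φ}

/-- The Morse-Lyapunov functions, as a subset of the space of Lyapunov functions. -/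
def morseLyapunovFunctions (f : M ≃ₘ^∞⟮𝓡 n, 𝓡 n⟯ M) : Set (LyapunovFunction f) :=
  {φ | IsMorseLyapunov f φ.1}

end MorseLyapunov

end

/-!
Let `p` be a periodic point of period `k` of the Morse-Smale diffeomorphism `f`, and `P` the
projection of `T_p M` onto the stable subspace `E^s` along the unstable subspace `E^u`. The proof
rests on the saddle function `|y_s|² - |y_u|²` in the chart at `p` (`splitFunction`), which does not
increase under a high iterate `f^(ik)` near `p` (`eventually_iterate_splitFunction_le`).

*Tangent spaces.* Along a curve in `W^s(p)` the iterates converge to `p` uniformly, so the saddle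
function, being non-increasing with limit `0`, is non-negative on the iterates of the curve. Hence
the iterates of the velocity never leave the stable cone, which forces the velocity into `E^s`
(`IsStableCurve.apply_velocity`). Applied to the inverse of `f`, the same argument puts velocities
of curves in `W^u(p)` into `E^u`. Transversality at `p` itself says that these velocities span
`T_p M`, so they fill `E^s` and `E^u` (`IsMorseSmale.exists_stableCurve`); no stable manifold theorem
is needed.

*Openness.* A Lyapunov function is automatically minimal at `p` on `W^s(p)` and maximal on `W^u(p)`,
so `p` is critical, and being Morse-Lyapunov means that the Hessian at each of the finitely many
periodic points is positive definite on `E^s` and negative definite on `E^u`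
(`IsLyapunov.isMorseLyapunov_iff`). This is an open condition on the second derivatives.

*Density.* Extend the germs of the saddle functions at the periodic points to a smooth function `ψ₀`,
take a large common multiple `N` of the periods, and let `ψ = ∑_{j < N} ψ₀ ∘ f^j`. Since
`ψ ∘ f - ψ = ψ₀ ∘ f^N - ψ₀`, the function `ψ` does not increase along orbits near the periodic
points, and it is non-degenerate on the invariant manifolds (`IsMorseSmale.exists_local_lyapunov`).
By compactness `φ + ε ψ` is again Lyapunov for small `ε > 0` (`IsLyapunov.eventually_add_smul`); its
second derivatives along stable curves are those of `φ`, which are non-negative, plus `ε` times those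
of `ψ`, which are positive, and symmetrically along unstable curves.
-/

namespace MorseLyapunov

/-! ### Hyperbolic splittings -/

section Splitting

variable {E : Type*} [NormedAddCommGroup E] [NormedSpace ℝ E]

/-- `P` is the projection onto the stable subspace of the hyperbolic map `A` along the unstable one:
`A` preserves the splitting `v = P v + (v - P v)`, its powers contract the first component
exponentially and expand the second one exponentially. Encoding the two subspaces by the projection
makes the splitting of the inverse map that of `1 - P`. -/
structure IsHyperbolicSplitting (A P : E →L[ℝ] E) : Prop where
  idem : ∀ v, P (P v) = P v
  comm : ∀ v, P (A v) = A (P v)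
  bound : ∃ C r : ℝ, 0 < C ∧ 0 < r ∧ r < 1 ∧ ∀ (v : E) (m : ℕ),
    ‖(A ^ m) (P v)‖ ≤ C * r ^ m * ‖P v‖ ∧ ‖v - P v‖ ≤ C * r ^ m * ‖(A ^ m) (v - P v)‖

theorem IsHyperbolicSplitting.comm_pow {A P : E →L[ℝ] E} (h : IsHyperbolicSplitting A P) (m : ℕ)
    (v : E) : P ((A ^ m) v) = (A ^ m) (P v) := by
  induction m generalizing v with
  | zero => simp
  | succ m ih => simp only [pow_succ, mul_apply_eq_comp, ih, h.comm]

theorem IsHyperbolicSplitting.symm {A A' P : E →L[ℝ] E} (h : IsHyperbolicSplitting A P)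
    (h₁ : A * A' = 1) (h₂ : A' * A = 1) :
    IsHyperbolicSplitting A' (1 - P) := by
  have key (m : ℕ) (v : E) : (A ^ m) ((A' ^ m) v) = v := by
    have hc : Commute A A' := by rw [Commute, SemiconjBy, h₁, h₂]
    rw [← mul_apply_eq_comp, ← hc.mul_pow, h₁, one_pow, one_apply_eq_self]
  have key₂ (v : E) : A' (A v) = v := by
    rw [← mul_apply_eq_comp, h₂, one_apply_eq_self]
  have hcomm (v : E) : P (A' v) = A' (P v) := by
    have := h.comm (A' v)
    rw [show A (A' v) = v by simpa using key 1 v] at this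
    rw [this, key₂]
  have hcomm' (m : ℕ) (v : E) : P ((A' ^ m) v) = (A' ^ m) (P v) := by
    induction m generalizing v with
    | zero => simp
    | succ m ih => simp only [pow_succ, mul_apply_eq_comp, ih, hcomm]
  obtain ⟨C, r, hC, hr, hr1, hb⟩ := h.bound
  refine ⟨fun v => by simp [h.idem], fun v => by simp [hcomm], C, r, hC, hr, hr1, fun v m => ?_⟩
  have h1 := (hb ((A' ^ m) v) m).2
  have h2 := (hb ((A' ^ m) v) m).1
  rw [hcomm', ← map_sub, key] at h1
  rw [hcomm', key] at h2
  simpa only [sub_apply, one_apply_eq_self, sub_sub_cancel] using ⟨h1, h2⟩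

/-- A high enough power of a hyperbolic map contracts and expands by the factor `2`. -/
theorem IsHyperbolicSplitting.eventually_pow {A P : E →L[ℝ] E} (h : IsHyperbolicSplitting A P) :
    ∀ᶠ m : ℕ in atTop, ∀ v : E,
      2 * ‖(A ^ m) (P v)‖ ≤ ‖P v‖ ∧ 2 * ‖v - P v‖ ≤ ‖(A ^ m) (v - P v)‖ := by
  obtain ⟨C, r, hC, hr, hr1, hb⟩ := h.bound
  have ht : Tendsto (fun m : ℕ => C * r ^ m) atTop (𝓝 0) := by
    simpa using (tendsto_pow_atTop_nhds_zero_of_lt_one hr.le hr1).const_mul C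
  filter_upwards [ht.eventually_lt_const (show (0 : ℝ) < 1 / 2 by norm_num)] with m hm v
  obtain ⟨h1, h2⟩ := hb v m
  constructor
  · nlinarith [norm_nonneg (P v)]
  · nlinarith [norm_nonneg ((A ^ m) (v - P v))]

/-- The quadratic form `|v_s|² - |v_u|²`, where `v_s = P v` and `v_u = v - P v`. -/
def splitForm (P : E →L[ℝ] E) (v : E) : ℝ := ‖P v‖ ^ 2 - ‖v - P v‖ ^ 2

theorem splitForm_smul (P : E →L[ℝ] E) (c : ℝ) (v : E) :
    splitForm P (c • v) = c ^ 2 * splitForm P v := by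
  rw [splitForm, splitForm, map_smul, ← smul_sub, norm_smul, norm_smul, mul_pow, mul_pow,
    Real.norm_eq_abs, sq_abs]
  ring

/-- If `B` contracts the range of `P` and expands its kernel, then a map with differential `B` at
its fixed point `y₀` does not increase `splitForm P (· - y₀)` near `y₀`. -/
theorem eventually_splitForm_le {B P : E →L[ℝ] E} (hcomm : ∀ v, P (B v) = B (P v))
    (hB : ∀ v : E, 2 * ‖B (P v)‖ ≤ ‖P v‖ ∧ 2 * ‖v - P v‖ ≤ ‖B (v - P v)‖)
    {g : E → E} {y₀ : E} (hg : HasFDerivAt g B y₀) (hy₀ : g y₀ = y₀) :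
    ∀ᶠ y in 𝓝 y₀, splitForm P (g y - y₀) ≤ splitForm P (y - y₀) := by
  set K : ℝ := ‖P‖ + 1 with hK
  have hKpos : 0 < K := by positivity
  -- A remainder of size `|h| / 10` is absorbed by the factors `1 / 2` and `2`.
  have hδ : 0 < 1 / (10 * K) := by positivity
  filter_upwards [hg.isLittleO.def hδ] with y hy
  rw [hy₀] at hy
  set h := y - y₀
  set e := g y - y₀ - B h with he
  have hge : g y - y₀ = B h + e := by rw [he]; abel
  have hPe : ‖P e‖ ≤ ‖P‖ * ‖e‖ := P.le_opNorm e
  have hKe : K * ‖e‖ ≤ ‖h‖ / 10 := by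
    calc K * ‖e‖ ≤ K * (1 / (10 * K) * ‖h‖) := by gcongr
      _ = ‖h‖ / 10 := by field_simp
  have hh : ‖h‖ ≤ ‖P h‖ + ‖h - P h‖ := by
    simpa using norm_add_le (P h) (h - P h)
  obtain ⟨h1, h2⟩ := hB h
  have hsub : ‖e - P e‖ ≤ K * ‖e‖ := by
    have := norm_sub_le e (P e)
    linarith [show K * ‖e‖ = ‖P‖ * ‖e‖ + ‖e‖ by rw [hK]; ring]
  have hPe' : ‖P e‖ ≤ K * ‖e‖ := by
    linarith [show K * ‖e‖ = ‖P‖ * ‖e‖ + ‖e‖ by rw [hK]; ring, norm_nonneg e]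
  have ha : ‖P (g y - y₀)‖ ≤ ‖B (P h)‖ + ‖P e‖ := by
    rw [hge, map_add, hcomm]; exact norm_add_le _ _
  have hb : ‖B (h - P h)‖ ≤ ‖(g y - y₀) - P (g y - y₀)‖ + ‖e - P e‖ := by
    have : B (h - P h) = ((g y - y₀) - P (g y - y₀)) - (e - P e) := by
      rw [hge, map_add, hcomm, map_sub]; abel
    rw [this]; exact norm_sub_le _ _
  have ha0 := norm_nonneg (P (g y - y₀))
  have hb0 := norm_nonneg ((g y - y₀) - P (g y - y₀))
  unfold splitForm
  generalize ‖P (g y - y₀)‖ = a at *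
  generalize ‖(g y - y₀) - P (g y - y₀)‖ = b at *
  have hs0 := norm_nonneg (P h)
  have hu0 := norm_nonneg (h - P h)
  generalize ‖P h‖ = s at *
  generalize ‖h - P h‖ = u at *
  have ha' : a ≤ 0.6 * s + 0.1 * u := by linarith
  have hb' : 1.9 * u - 0.1 * s ≤ b := by linarith
  rcases le_total u (s / 2) with hus | hus
  -- In the stable cone `u ≤ s / 2` the contraction suffices; outside it the expansion is needed.
  · nlinarith
  · have : 1.7 * u ≤ b := by linarith
    nlinarith

end Splitting

/-! ### Second derivatives -/

section Calculus

variable {E F : Type*} [NormedAddCommGroup E] [NormedSpace ℝ E]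
  [NormedAddCommGroup F] [NormedSpace ℝ F]

/-- The chain rule for the Hessian at a critical point. -/
theorem fderiv_fderiv_comp_of_fderiv_eq_zero {u : F → ℝ} {τ : E → F} {y : E}
    (hu : ContDiffAt ℝ 2 u (τ y)) (hτ : ContDiffAt ℝ 2 τ y) (h0 : fderiv ℝ u (τ y) = 0) (v w : E) :
    fderiv ℝ (fderiv ℝ (u ∘ τ)) y v w =
      fderiv ℝ (fderiv ℝ u) (τ y) (fderiv ℝ τ y v) (fderiv ℝ τ y w) := by
  have h1 : fderiv ℝ (u ∘ τ) =ᶠ[𝓝 y] fun z => (fderiv ℝ u (τ z)).comp (fderiv ℝ τ z) := by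
    have hu' := hτ.continuousAt.eventually (hu.eventually (by simp))
    filter_upwards [hu', hτ.eventually (by simp)] with z hz hz'
    exact fderiv_comp z (hz.differentiableAt (by simp)) (hz'.differentiableAt (by simp))
  rw [h1.fderiv_eq]
  have hdu : DifferentiableAt ℝ (fderiv ℝ u) (τ y) :=
    (hu.fderiv_right (m := 1) (by norm_num)).differentiableAt (by simp)
  have hdτ : DifferentiableAt ℝ (fderiv ℝ τ) y :=
    (hτ.fderiv_right (m := 1) (by norm_num)).differentiableAt (by simp)
  have hτ1 : DifferentiableAt ℝ τ y := hτ.differentiableAt (by simp)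
  have h2 := (hdu.hasFDerivAt.comp y hτ1.hasFDerivAt).clm_comp hdτ.hasFDerivAt
  have h3 : HasFDerivAt (fun z => (fderiv ℝ u (τ z)).comp (fderiv ℝ τ z)) _ y := h2
  rw [h3.fderiv]
  simp [h0]

theorem iteratedDeriv_two_eq_deriv_deriv (g : ℝ → ℝ) : iteratedDeriv 2 g = deriv (deriv g) := by
  rw [iteratedDeriv_succ, iteratedDeriv_one]

/-- The second-order condition at a minimum. -/
theorem iteratedDeriv_two_nonneg_of_isLocalMin {g : ℝ → ℝ} {a : ℝ} (hg : ContinuousAt g a)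
    (h : IsLocalMin g a) : 0 ≤ iteratedDeriv 2 g a := by
  rw [iteratedDeriv_two_eq_deriv_deriv]
  by_contra! hlt
  have hmax := isLocalMax_of_deriv_deriv_neg hlt h.deriv_eq_zero hg
  have hc : g =ᶠ[𝓝 a] fun _ => g a := by
    filter_upwards [h, hmax] with x h1 h2 using le_antisymm h2 h1
  rw [hc.deriv.deriv_eq] at hlt
  simp at hlt

theorem iteratedDeriv_two_comp_of_fderiv_eq_zero {u : F → ℝ} {η : ℝ → F} {a : ℝ}
    (hu : ContDiffAt ℝ 2 u (η a)) (hη : ContDiffAt ℝ 2 η a) (h0 : fderiv ℝ u (η a) = 0) :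
    iteratedDeriv 2 (u ∘ η) a = fderiv ℝ (fderiv ℝ u) (η a) (deriv η a) (deriv η a) := by
  have := fderiv_fderiv_comp_of_fderiv_eq_zero hu hη h0 1 1
  rw [fderiv_apply_one_eq_deriv (f := η)] at this
  rw [← this, iteratedDeriv_eq_iteratedFDeriv, iteratedFDeriv_two_apply]

variable {G : Type*} [NormedAddCommGroup G] [InnerProductSpace ℝ G]

theorem iteratedDeriv_two_norm_sq {ξ : ℝ → G} {a : ℝ} (hξ : ContDiffAt ℝ 2 ξ a) (h0 : ξ a = 0) :
    iteratedDeriv 2 (fun t => ‖ξ t‖ ^ 2) a = 2 * ‖deriv ξ a‖ ^ 2 := by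
  have h1 : deriv (fun t => ‖ξ t‖ ^ 2) =ᶠ[𝓝 a] fun t => 2 * inner ℝ (ξ t) (deriv ξ t) := by
    filter_upwards [hξ.eventually (by simp)] with t ht
    exact (ht.differentiableAt (by simp)).hasDerivAt.norm_sq.deriv
  rw [iteratedDeriv_two_eq_deriv_deriv, h1.deriv_eq]
  have hd : DifferentiableAt ℝ ξ a := hξ.differentiableAt (by simp)
  have hd2 : DifferentiableAt ℝ (deriv ξ) a :=
    ((hξ.fderiv_right (m := 1) (by norm_num)).differentiableAt (by simp)).clm_apply
      (differentiableAt_const (1 : ℝ))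
  rw [((hd.hasDerivAt.inner ℝ hd2.hasDerivAt).const_mul 2).deriv, h0, inner_zero_left, zero_add,
    real_inner_self_eq_norm_sq]

theorem iteratedDeriv_two_splitForm (P : G →L[ℝ] G) {η : ℝ → G} {a : ℝ}
    (hη : ContDiffAt ℝ 2 η a) :
    iteratedDeriv 2 (fun t => splitForm P (η t - η a)) a = 2 * splitForm P (deriv η a) := by
  have h1 : ContDiffAt ℝ 2 (fun t => P (η t - η a)) a :=
    P.contDiff.contDiffAt.comp a (hη.sub contDiffAt_const)
  have h2 : ContDiffAt ℝ 2 (fun t => (η t - η a) - P (η t - η a)) a :=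
    (hη.sub contDiffAt_const).sub h1
  have hd : HasDerivAt (fun t => η t - η a) (deriv η a) a :=
    (hη.differentiableAt (by simp)).hasDerivAt.sub_const _
  have hP : HasDerivAt (fun t => P (η t - η a)) (P (deriv η a)) a :=
    P.hasFDerivAt.comp_hasDerivAt a hd
  have e1 := iteratedDeriv_two_norm_sq h1 (by simp)
  have e2 := iteratedDeriv_two_norm_sq h2 (by simp)
  rw [hP.deriv] at e1
  rw [(hd.fun_sub hP).deriv] at e2
  have := iteratedDeriv_fun_sub (n := 2) (h1.norm_sq ℝ) (h2.norm_sq ℝ)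
  simp only [splitForm]
  rw [this, e1, e2]; ring

end Calculus

variable {n : ℕ} {M : Type*} [TopologicalSpace M] [ChartedSpace (EuclideanSpace ℝ (Fin n)) M]

/-! ### Periodic points of the inverse -/

section Periodic

theorem iterate_symm_eq_iff (f : M ≃ₘ^∞⟮𝓡 n, 𝓡 n⟯ M) (m : ℕ) (p : M) :
    f.symm^[m] p = p ↔ f^[m] p = p := by
  have h₁ : LeftInverse f^[m] f.symm^[m] := LeftInverse.iterate f.apply_symm_apply m
  have h₂ : LeftInverse f.symm^[m] f^[m] := LeftInverse.iterate f.symm_apply_apply m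
  constructor <;> intro h
  · conv_lhs => rw [← h, h₁]
  · conv_lhs => rw [← h, h₂]

theorem minimalPeriod_symm (f : M ≃ₘ^∞⟮𝓡 n, 𝓡 n⟯ M) (p : M) :
    minimalPeriod f.symm p = minimalPeriod f p :=
  minimalPeriod_eq_minimalPeriod_iff.2 fun m => iterate_symm_eq_iff f m p

end Periodic

/-! ### Differentials at periodic points -/

section Differentials

theorem hasMFDerivAt_comp_of_eq {g h : M → M} {p : M}
    {A B : EuclideanSpace ℝ (Fin n) →L[ℝ] EuclideanSpace ℝ (Fin n)}
    (hg : HasMFDerivAt (𝓡 n) (𝓡 n) g p B) (hh : HasMFDerivAt (𝓡 n) (𝓡 n) h p A) (hp : h p = p) :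
    HasMFDerivAt (𝓡 n) (𝓡 n) (g ∘ h) p (B * A) := by
  have hg' : HasMFDerivAt (𝓡 n) (𝓡 n) g (h p) B := by rw [hp]; exact hg
  exact hg'.comp p hh

theorem hasMFDerivAt_iterate {g : M → M} {p : M}
    {A : EuclideanSpace ℝ (Fin n) →L[ℝ] EuclideanSpace ℝ (Fin n)}
    (hg : HasMFDerivAt (𝓡 n) (𝓡 n) g p A) (hp : g p = p) (m : ℕ) :
    HasMFDerivAt (𝓡 n) (𝓡 n) g^[m] p (A ^ m) := by
  induction m with
  | zero => exact hasMFDerivAt_id p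
  | succ m ih => rw [iterate_succ, pow_succ]; exact hasMFDerivAt_comp_of_eq ih hg hp

theorem contMDiff_iterate (f : M ≃ₘ^∞⟮𝓡 n, 𝓡 n⟯ M) (m : ℕ) :
    ContMDiff (𝓡 n) (𝓡 n) ∞ f^[m] := by
  induction m with
  | zero => exact contMDiff_id
  | succ m ih => rw [iterate_succ]; exact ih.comp f.contMDiff

theorem hasMFDerivAt_iterate_returnDeriv (f : M ≃ₘ^∞⟮𝓡 n, 𝓡 n⟯ M) (p : M) (m : ℕ) :
    HasMFDerivAt (𝓡 n) (𝓡 n) f^[m * minimalPeriod f p] p (returnDeriv f p ^ m) := by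
  have h : HasMFDerivAt (𝓡 n) (𝓡 n) f^[minimalPeriod f p] p (returnDeriv f p) :=
    ((contMDiff_iterate f _).mdifferentiableAt (by simp)).hasMFDerivAt
  rw [mul_comm, iterate_mul]
  exact hasMFDerivAt_iterate h iterate_minimalPeriod m

theorem returnDeriv_symm_mul (f : M ≃ₘ^∞⟮𝓡 n, 𝓡 n⟯ M) (p : M) :
    returnDeriv f.symm p * returnDeriv f p = 1 := by
  have h₁ := hasMFDerivAt_iterate_returnDeriv f p 1
  have h₂ := hasMFDerivAt_iterate_returnDeriv f.symm p 1
  rw [one_mul, pow_one] at h₁ h₂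
  have h := hasMFDerivAt_comp_of_eq h₂ h₁ iterate_minimalPeriod
  rw [minimalPeriod_symm] at h
  have hid : f.symm^[minimalPeriod f p] ∘ f^[minimalPeriod f p] = id :=
    funext (LeftInverse.iterate f.symm_apply_apply _)
  rw [hid] at h
  exact hasMFDerivAt_unique h (hasMFDerivAt_id p)

theorem IsHyperbolicAt.exists_splitting {f : M ≃ₘ^∞⟮𝓡 n, 𝓡 n⟯ M} {p : M}
    (h : IsHyperbolicAt f p) : ∃ P, IsHyperbolicSplitting (returnDeriv f p) P := by
  obtain ⟨Es, Eu, hc, hs, hu, C, r, hC, hr, hr1, hbs, hbu⟩ := h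
  have hmem (v) : v - Es.projection Eu hc v ∈ Eu := by
    rw [← Submodule.projection_apply_eq_zero_iff hc, map_sub,
      Submodule.projection_apply_of_mem_left hc (Submodule.projection_apply_mem hc v), sub_self]
  refine ⟨LinearMap.toContinuousLinearMap (Es.projection Eu hc), fun v => ?_, fun v => ?_,
    C, r, hC, hr, hr1, fun v m => ⟨hbs _ (Submodule.projection_apply_mem hc v) m, hbu _ (hmem v) m⟩⟩
  · exact Submodule.projection_apply_of_mem_left hc (Submodule.projection_apply_mem hc v)
  · have h₁ := Submodule.projection_apply_of_mem_left hc (hs _ (Submodule.projection_apply_mem hc v))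
    have h₂ := Submodule.projection_apply_of_mem_right hc (hu _ (hmem v))
    rw [map_sub, map_sub, h₁, sub_eq_zero] at h₂
    exact h₂

theorem hasDerivAt_extChartAt_comp {γ : ℝ → M} {p : M} (hp : γ 0 = p)
    {L : ℝ →L[ℝ] EuclideanSpace ℝ (Fin n)} (h : HasMFDerivAt 𝓘(ℝ, ℝ) (𝓡 n) γ 0 L) :
    HasDerivAt (fun t => extChartAt (𝓡 n) p (γ t)) (L 1) 0 := by
  subst hp
  have h₂ : HasFDerivWithinAt (fun t : ℝ => extChartAt (𝓡 n) (γ 0) (γ t)) L univ 0 := by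
    simpa only [writtenInExtChartAt, mfld_simps] using! h.2
  exact (hasFDerivWithinAt_univ.1 h₂).hasDerivAt

theorem hasFDerivAt_extChartAt_comp {F : M → M} {p : M} (hp : F p = p)
    {B : EuclideanSpace ℝ (Fin n) →L[ℝ] EuclideanSpace ℝ (Fin n)}
    (h : HasMFDerivAt (𝓡 n) (𝓡 n) F p B) :
    HasFDerivAt (fun y => extChartAt (𝓡 n) p (F ((extChartAt (𝓡 n) p).symm y))) B
      (extChartAt (𝓡 n) p p) := by
  have h₂ : HasFDerivWithinAt (fun y => extChartAt (𝓡 n) (F p) (F ((extChartAt (𝓡 n) p).symm y))) B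
      univ (extChartAt (𝓡 n) p p) := by
    simpa only [writtenInExtChartAt, ModelWithCorners.range_eq_univ] using! h.2
  rw [hp] at h₂
  exact hasFDerivWithinAt_univ.1 h₂

end Differentials

/-! ### The saddle function in a chart -/

section SplitFunction

/-- The function `|y_s|² - |y_u|²` in the preferred chart at `p`, centred at `p`, where `y_s` and
`y_u` are the components of `y` given by the projection `P` (see `splitForm`). -/
noncomputable def splitFunction (P : EuclideanSpace ℝ (Fin n) →L[ℝ] EuclideanSpace ℝ (Fin n)) (p x : M) : ℝ :=
  splitForm P (extChartAt (𝓡 n) p x - extChartAt (𝓡 n) p p)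

theorem eventually_splitFunction_le
    {B P : EuclideanSpace ℝ (Fin n) →L[ℝ] EuclideanSpace ℝ (Fin n)}
    (hcomm : ∀ v, P (B v) = B (P v))
    (hB : ∀ v, 2 * ‖B (P v)‖ ≤ ‖P v‖ ∧ 2 * ‖v - P v‖ ≤ ‖B (v - P v)‖)
    {F : M → M} {p : M} (hF : HasMFDerivAt (𝓡 n) (𝓡 n) F p B) (hp : F p = p) :
    ∀ᶠ x in 𝓝 p, splitFunction P p (F x) ≤ splitFunction P p x := by
  have h := eventually_splitForm_le hcomm hB (hasFDerivAt_extChartAt_comp hp hF)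
    (by rw [extChartAt_to_inv, hp])
  filter_upwards [(continuousAt_extChartAt p).eventually h, extChartAt_source_mem_nhds (I := 𝓡 n) p]
    with x hx hxs
  rwa [PartialEquiv.left_inv _ hxs] at hx

theorem eventually_iterate_splitFunction_le {f : M ≃ₘ^∞⟮𝓡 n, 𝓡 n⟯ M} {p : M}
    {P : EuclideanSpace ℝ (Fin n) →L[ℝ] EuclideanSpace ℝ (Fin n)}
    (hP : IsHyperbolicSplitting (returnDeriv f p) P) :
    ∀ᶠ i in atTop, ∀ᶠ x in 𝓝 p,
      splitFunction P p (f^[i * minimalPeriod f p] x) ≤ splitFunction P p x := by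
  filter_upwards [hP.eventually_pow] with i hi
  refine eventually_splitFunction_le (hP.comm_pow i) hi (hasMFDerivAt_iterate_returnDeriv f p i) ?_
  exact (isPeriodicPt_minimalPeriod f p).const_mul i

theorem splitFunction_self
    (P : EuclideanSpace ℝ (Fin n) →L[ℝ] EuclideanSpace ℝ (Fin n)) (p : M) :
    splitFunction P p p = 0 := by
  simp [splitFunction, splitForm]

theorem continuousAt_splitFunction
    (P : EuclideanSpace ℝ (Fin n) →L[ℝ] EuclideanSpace ℝ (Fin n)) (p : M) :
    ContinuousAt (splitFunction P p) p := by
  have h : Continuous fun y => splitForm P (y - extChartAt (𝓡 n) p p) := by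
    unfold splitForm; fun_prop
  exact h.continuousAt.comp (continuousAt_extChartAt p)

/-- The velocity at `p` of a curve in `W^s(p)` has no unstable component. -/
theorem IsStableCurve.apply_velocity {f : M ≃ₘ^∞⟮𝓡 n, 𝓡 n⟯ M} {p : M}
    {P : EuclideanSpace ℝ (Fin n) →L[ℝ] EuclideanSpace ℝ (Fin n)}
    (hP : IsHyperbolicSplitting (returnDeriv f p) P) {γ : ℝ → M} (hγ : IsStableCurve f p γ)
    (hp : γ 0 = p) : P (velocity γ) = velocity γ := by
  set k := minimalPeriod f p with hk
  set v := velocity (n := n) γ with hv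
  have hfix (m : ℕ) : f^[m * k] p = p := (isPeriodicPt_minimalPeriod f p).const_mul m
  obtain ⟨i, hi, hi1⟩ :=
    ((eventually_iterate_splitFunction_le hP).and (eventually_ge_atTop 1)).exists
  -- The iterates of the curve stay where `splitFunction` decreases to its value `0` at `p`.
  have hpos : ∀ᶠ q : ℕ × ℝ in atTop ×ˢ 𝓝 0, 0 ≤ splitFunction P p (f^[q.1 * k] (γ q.2)) := by
    have h1 := (hγ.locallyUniform 0).eventually hi
    rw [eventually_prod_iff] at h1 ⊢
    obtain ⟨pa, ha, pb, hb, hab⟩ := h1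
    rw [eventually_atTop] at ha
    obtain ⟨m₀, hm₀⟩ := ha
    refine ⟨_, eventually_ge_atTop m₀, pb, hb, fun {m} hm {t} ht => ?_⟩
    have hanti : Antitone fun j : ℕ => splitFunction P p (f^[(m + i * j) * k] (γ t)) := by
      refine antitone_nat_of_succ_le fun j => ?_
      have := hab (hm₀ (m + i * j) (by omega)) ht
      rw [← iterate_add_apply] at this
      rwa [show (m + i * (j + 1)) * k = i * k + (m + i * j) * k by ring]
    have hlim : Tendsto (fun j : ℕ => splitFunction P p (f^[(m + i * j) * k] (γ t))) atTop
        (𝓝 (splitFunction P p p)) := by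
      refine (continuousAt_splitFunction P p).tendsto.comp ((hγ.mem t).comp ?_)
      refine tendsto_atTop_mono (fun j => ?_) tendsto_id
      simp only [id]; nlinarith
    have := hanti.le_of_tendsto hlim 0
    rw [splitFunction_self] at this
    simpa using this
  have hder (m : ℕ) : HasDerivAt (fun t => extChartAt (𝓡 n) p (f^[m * k] (γ t)))
      ((returnDeriv f p ^ m) v) 0 := by
    have h1 : HasMFDerivAt (𝓡 n) (𝓡 n) f^[m * k] (γ 0) (returnDeriv f p ^ m) := by
      rw [hp]; exact hasMFDerivAt_iterate_returnDeriv f p m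
    have h2 : HasMFDerivAt 𝓘(ℝ, ℝ) (𝓡 n) γ 0 (mfderiv 𝓘(ℝ, ℝ) (𝓡 n) γ 0) :=
      (hγ.smooth.mdifferentiableAt (by simp)).hasMFDerivAt
    exact hasDerivAt_extChartAt_comp (by rw [comp_apply, hp, hfix]) (h1.comp 0 h2)
  have hform : ∀ᶠ m : ℕ in atTop, 0 ≤ splitForm P ((returnDeriv f p ^ m) v) := by
    filter_upwards [hpos.curry] with m hm
    have hslope := (hder m).tendsto_slope_zero
    have hcont : Continuous (splitForm P) := by unfold splitForm; fun_prop
    refine ge_of_tendsto ((hcont.tendsto _).comp hslope) ?_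
    filter_upwards [hm.filter_mono nhdsWithin_le_nhds] with t ht
    rw [splitFunction] at ht
    simp only [comp_apply, zero_add, splitForm_smul, hp, hfix]
    positivity
  obtain ⟨C, r, hC, hr, hr1, hb⟩ := hP.bound
  have hlim : Tendsto (fun m : ℕ => (C * r ^ m) * ((C * r ^ m) * ‖P v‖)) atTop (𝓝 0) := by
    have h0 : Tendsto (fun m : ℕ => C * r ^ m) atTop (𝓝 0) := by
      simpa using (tendsto_pow_atTop_nhds_zero_of_lt_one hr.le hr1).const_mul C
    simpa using h0.mul (h0.mul_const ‖P v‖)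
  have hle : ‖v - P v‖ ≤ 0 := by
    refine ge_of_tendsto hlim ?_
    filter_upwards [hform] with m hm
    rw [splitForm, hP.comm_pow, ← map_sub, sub_nonneg] at hm
    have hm' := (pow_le_pow_iff_left₀ (norm_nonneg _) (norm_nonneg _) two_ne_zero).1 hm
    refine (hb v m).2.trans ?_
    gcongr
    exact hm'.trans (hb v m).1
  exact (sub_eq_zero.1 (norm_le_zero_iff.1 hle)).symm

end SplitFunction

/-! ### Curves in stable manifolds -/

section StableCurves

theorem iterate_mem_periodicPts {α : Type*} {f : α → α} {p : α} (hp : p ∈ periodicPts f) (j : ℕ) :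
    f^[j] p ∈ periodicPts f :=
  ⟨_, minimalPeriod_pos_of_mem_periodicPts hp, (isPeriodicPt_minimalPeriod f p).apply_iterate j⟩

/-- Stable curves are mapped to stable curves by the diffeomorphisms commuting with `f`. -/
theorem IsStableCurve.map {f : M ≃ₘ^∞⟮𝓡 n, 𝓡 n⟯ M} {p : M} {γ : ℝ → M}
    (hγ : IsStableCurve f p γ) (g : M ≃ₘ^∞⟮𝓡 n, 𝓡 n⟯ M) (hg : Function.Commute f g)
    (hper : minimalPeriod f (g p) = minimalPeriod f p) : IsStableCurve f (g p) (g ∘ γ) where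
  smooth := g.contMDiff.comp hγ.smooth
  mem t := by
    have h := (g.continuous.tendsto p).comp (hγ.mem t)
    refine h.congr fun m => ?_
    rw [comp_apply, hper, comp_apply, (hg.iterate_left _).eq]
  locallyUniform t := by
    have h := (g.continuous.tendsto p).comp (hγ.locallyUniform t)
    refine h.congr fun q => ?_
    rw [comp_apply, hper, comp_apply, (hg.iterate_left _).eq]

theorem velocity_comp_ne_zero (g : M ≃ₘ^∞⟮𝓡 n, 𝓡 n⟯ M) {γ : ℝ → M}
    (hγ : ContMDiff 𝓘(ℝ, ℝ) (𝓡 n) ∞ γ) (h : velocity (n := n) γ ≠ 0) :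
    velocity (n := n) (g ∘ γ) ≠ 0 := by
  intro h0
  apply h
  have h1 : MDifferentiableAt 𝓘(ℝ, ℝ) (𝓡 n) (g ∘ γ) 0 :=
    (g.contMDiff.comp hγ).mdifferentiableAt (by simp)
  have h2 : MDifferentiableAt (𝓡 n) (𝓡 n) g.symm ((g ∘ γ) 0) :=
    g.symm.contMDiff.mdifferentiableAt (by simp)
  have hc := mfderiv_comp 0 h2 h1
  have hid : g.symm ∘ (g ∘ γ) = γ := by
    funext t; exact g.symm_apply_apply _
  rw [hid] at hc
  rw [velocity, hc]
  exact (congrArg (mfderiv (𝓡 n) (𝓡 n) g.symm ((g ∘ γ) 0)) h0).trans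
    (ContinuousLinearMap.map_zero _)

theorem commute_symm (f : M ≃ₘ^∞⟮𝓡 n, 𝓡 n⟯ M) : Function.Commute f.symm f := fun x => by
  rw [f.symm_apply_apply, f.apply_symm_apply]

/-- Applying `f` to a moving stable curve gives a moving stable curve at the next point of the
orbit. It is stated for the stable curves of a diffeomorphism `g` commuting with `f`, so as to cover
both `g = f` and `g = f.symm`. -/
theorem IsStableCurve.iterate {f g : M ≃ₘ^∞⟮𝓡 n, 𝓡 n⟯ M} (hg : Function.Commute g f)
    (hper : ∀ p ∈ periodicPts f, minimalPeriod g (f p) = minimalPeriod g p)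
    {p : M} (hp : p ∈ periodicPts f) {γ : ℝ → M} (hγ : IsStableCurve g p γ)
    (hv : velocity (n := n) γ ≠ 0) (j : ℕ) :
    IsStableCurve g (f^[j] p) (f^[j] ∘ γ) ∧ velocity (n := n) (f^[j] ∘ γ) ≠ 0 := by
  induction j with
  | zero => exact ⟨hγ, hv⟩
  | succ j ih =>
    rw [iterate_succ', comp_apply, comp_assoc]
    exact ⟨ih.1.map f hg (hper _ (iterate_mem_periodicPts hp j)),
      velocity_comp_ne_zero f ih.1.smooth ih.2⟩

/-- A function that does not increase along the orbits is minimal at `p` on `W^s(p)`. Periodicity of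
`p` is not needed: otherwise its minimal period is `0` by convention, and `stableManifold f p`
consists of the points that lie in every neighbourhood of `p`. -/
theorem isMinOn_stableManifold {f : M ≃ₘ^∞⟮𝓡 n, 𝓡 n⟯ M} {u : M → ℝ} (hu : Continuous u)
    (hdec : ∀ x, u (f x) ≤ u x) (p : M) :
    IsMinOn u (stableManifold f p) p := by
  intro x hx
  have hanti : Antitone fun m : ℕ => u (f^[m] x) := by
    refine antitone_nat_of_succ_le fun m => ?_
    rw [iterate_succ', comp_apply]
    exact hdec _
  have hk : Monotone fun m : ℕ => m * minimalPeriod f p := fun a b h => Nat.mul_le_mul_right _ h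
  simpa using (hanti.comp_monotone hk).le_of_tendsto ((hu.tendsto p).comp hx) 0

theorem IsStableCurve.isLocalMin_comp {f : M ≃ₘ^∞⟮𝓡 n, 𝓡 n⟯ M} {u : M → ℝ} (hu : Continuous u)
    (hdec : ∀ x, u (f x) ≤ u x) {p : M} {γ : ℝ → M}
    (hγ : IsStableCurve f p γ) (h0 : γ 0 = p) : IsLocalMin (u ∘ γ) 0 :=
  Eventually.of_forall fun t => by
    rw [comp_apply, h0]; exact isMinOn_stableManifold hu hdec p (hγ.mem t)

theorem mem_stableManifold_self (f : M ≃ₘ^∞⟮𝓡 n, 𝓡 n⟯ M) (p : M) : p ∈ stableManifold f p := by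
  refine tendsto_const_nhds.congr fun m => ?_
  exact ((isPeriodicPt_minimalPeriod f p).const_mul m).symm

theorem IsStableCurve.iteratedDeriv_two_nonneg {f : M ≃ₘ^∞⟮𝓡 n, 𝓡 n⟯ M} {u : M → ℝ}
    (hu : Continuous u) (hdec : ∀ x, u (f x) ≤ u x) {p : M} {γ : ℝ → M}
    (hγ : IsStableCurve f p γ) (h0 : γ 0 = p) : 0 ≤ iteratedDeriv 2 (u ∘ γ) 0 :=
  iteratedDeriv_two_nonneg_of_isLocalMin (hu.comp hγ.smooth.continuous).continuousAt
    (hγ.isLocalMin_comp hu hdec h0)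

end StableCurves

/-! ### First and second derivatives in charts -/

section Coordinates

theorem hasDerivAt_extChartAt_velocity {γ : ℝ → M} (hγ : ContMDiff 𝓘(ℝ, ℝ) (𝓡 n) ∞ γ) {p : M}
    (hp : γ 0 = p) : HasDerivAt (fun t => extChartAt (𝓡 n) p (γ t)) (velocity (n := n) γ) 0 :=
  hasDerivAt_extChartAt_comp hp ((hγ.mdifferentiableAt (by simp)).hasMFDerivAt (x := 0))

theorem contDiffAt_extChartAt_comp [IsManifold (𝓡 n) ∞ M] {γ : ℝ → M}
    (hγ : ContMDiff 𝓘(ℝ, ℝ) (𝓡 n) ∞ γ) {p : M} (hp : γ 0 = p) :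
    ContDiffAt ℝ ∞ (fun t => extChartAt (𝓡 n) p (γ t)) 0 := by
  subst hp
  exact ((contMDiffAt_extChartAt (n := ∞) (x := γ 0)).comp 0 (hγ 0)).contDiffAt

theorem contDiffAt_comp_extChartAt_symm [IsManifold (𝓡 n) ∞ M] {φ : M → ℝ}
    (hφ : ContMDiff (𝓡 n) 𝓘(ℝ, ℝ) ∞ φ) (x : M) {y : EuclideanSpace ℝ (Fin n)}
    (hy : y ∈ (extChartAt (𝓡 n) x).target) :
    ContDiffAt ℝ ∞ (φ ∘ (extChartAt (𝓡 n) x).symm) y :=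
  (hφ.contMDiffAt.comp y ((contMDiffOn_extChartAt_symm (n := ∞) x).contMDiffAt
    ((isOpen_extChartAt_target x).mem_nhds hy))).contDiffAt

theorem comp_eventuallyEq_extChartAt {φ : M → ℝ} {γ : ℝ → M} (hγ : ContinuousAt γ 0) {p : M}
    (hp : γ 0 = p) :
    φ ∘ γ =ᶠ[𝓝 0] (φ ∘ (extChartAt (𝓡 n) p).symm) ∘ fun t => extChartAt (𝓡 n) p (γ t) := by
  have : ∀ᶠ t in 𝓝 0, γ t ∈ (extChartAt (𝓡 n) p).source :=
    hγ.eventually_mem (by rw [hp]; exact extChartAt_source_mem_nhds p)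
  filter_upwards [this] with t ht
  simp only [comp_apply, PartialEquiv.left_inv _ ht]

theorem mfderiv_eq_zero_iff_fderiv_chart {φ : M → ℝ}
    (hφ : ContMDiff (𝓡 n) 𝓘(ℝ, ℝ) ∞ φ) (x : M) :
    mfderiv (𝓡 n) 𝓘(ℝ, ℝ) φ x = 0 ↔
      fderiv ℝ (φ ∘ (extChartAt (𝓡 n) x).symm) (extChartAt (𝓡 n) x x) = 0 := by
  have h := ((hφ.mdifferentiableAt (by simp)).hasMFDerivAt (x := x)).2
  have h₂ : HasFDerivWithinAt (φ ∘ (extChartAt (𝓡 n) x).symm)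
      (show EuclideanSpace ℝ (Fin n) →L[ℝ] ℝ from mfderiv (𝓡 n) 𝓘(ℝ, ℝ) φ x)
      univ (extChartAt (𝓡 n) x x) := by
    simpa only [writtenInExtChartAt, ModelWithCorners.range_eq_univ] using! h
  rw [(hasFDerivWithinAt_univ.1 h₂).fderiv]
  exact Iff.rfl

/-- At a critical point the second derivative of `φ` along a curve depends on the velocity only. -/
theorem iteratedDeriv_two_comp_eq_chartHessian [IsManifold (𝓡 n) ∞ M] {φ : M → ℝ}
    (hφ : ContMDiff (𝓡 n) 𝓘(ℝ, ℝ) ∞ φ) {p : M} (hcrit : mfderiv (𝓡 n) 𝓘(ℝ, ℝ) φ p = 0)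
    {γ : ℝ → M} (hγ : ContMDiff 𝓘(ℝ, ℝ) (𝓡 n) ∞ γ) (hp : γ 0 = p) :
    iteratedDeriv 2 (φ ∘ γ) 0 = chartHessian φ p (velocity (n := n) γ) (velocity (n := n) γ) := by
  rw [mfderiv_eq_zero_iff_fderiv_chart hφ] at hcrit
  have h2 : (2 : WithTop ℕ∞) ≤ ∞ := by norm_cast
  rw [(comp_eventuallyEq_extChartAt (φ := φ) (n := n) hγ.continuous.continuousAt hp).iteratedDeriv_eq,
    iteratedDeriv_two_comp_of_fderiv_eq_zero, (hasDerivAt_extChartAt_velocity hγ hp).deriv, hp]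
  · rfl
  · rw [hp]
    exact (contDiffAt_comp_extChartAt_symm hφ p (mem_extChartAt_target p)).of_le h2
  · exact (contDiffAt_extChartAt_comp hγ hp).of_le h2
  · rw [hp]; exact hcrit

theorem fderiv_velocity_eq_zero [IsManifold (𝓡 n) ∞ M] {φ : M → ℝ}
    (hφ : ContMDiff (𝓡 n) 𝓘(ℝ, ℝ) ∞ φ) {p : M}
    {γ : ℝ → M} (hγ : ContMDiff 𝓘(ℝ, ℝ) (𝓡 n) ∞ γ) (hp : γ 0 = p) (h : deriv (φ ∘ γ) 0 = 0) :
    fderiv ℝ (φ ∘ (extChartAt (𝓡 n) p).symm) (extChartAt (𝓡 n) p p) (velocity γ) = 0 := by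
  rw [(comp_eventuallyEq_extChartAt (φ := φ) (n := n) hγ.continuous.continuousAt hp).deriv_eq] at h
  rw [← h]
  have h1 := ((contDiffAt_comp_extChartAt_symm hφ p (mem_extChartAt_target p)).differentiableAt
    (by simp)).hasFDerivAt
  rw [← hp] at h1
  have h2 := h1.comp_hasDerivAt (0 : ℝ) (hasDerivAt_extChartAt_velocity hγ rfl)
  rw [hp] at h2
  exact h2.deriv.symm

end Coordinates

/-! ### Lyapunov functions at periodic points -/

section Lyapunov

theorem IsLyapunov.apply_le {f : M ≃ₘ^∞⟮𝓡 n, 𝓡 n⟯ M} {φ : C^∞⟮𝓡 n, M; 𝓘(ℝ, ℝ), ℝ⟯}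
    (h : IsLyapunov f φ) (x : M) : φ (f x) ≤ φ x := by
  by_cases hx : x ∈ periodicPts f
  · exact (h.const x hx).le
  · exact (h.decreasing x hx).le

theorem IsLyapunov.neg_symm_apply_le {f : M ≃ₘ^∞⟮𝓡 n, 𝓡 n⟯ M}
    {φ : C^∞⟮𝓡 n, M; 𝓘(ℝ, ℝ), ℝ⟯} (h : IsLyapunov f φ) (x : M) : (-φ) (f.symm x) ≤ (-φ) x := by
  have := h.apply_le (f.symm x)
  rw [f.apply_symm_apply] at this
  simpa using this

/-- The periodic points are critical points of every Lyapunov function. -/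
theorem IsLyapunov.mfderiv_eq_zero [IsManifold (𝓡 n) ∞ M] {f : M ≃ₘ^∞⟮𝓡 n, 𝓡 n⟯ M}
    (hf : IsMorseSmale f) {φ : C^∞⟮𝓡 n, M; 𝓘(ℝ, ℝ), ℝ⟯} (h : IsLyapunov f φ) {p : M}
    (hp : p ∈ periodicPts f) : mfderiv (𝓡 n) 𝓘(ℝ, ℝ) φ p = 0 := by
  refine (mfderiv_eq_zero_iff_fderiv_chart φ.contMDiff p).2 (ContinuousLinearMap.ext fun w => ?_)
  obtain ⟨u, ⟨γ, hγ, h0, rfl⟩, v, ⟨δ, hδ, h0', rfl⟩, rfl⟩ := hf.transversal p hp p hp p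
    ⟨mem_stableManifold_self f.symm p, mem_stableManifold_self f p⟩ w
  have hmax : IsLocalMin ((-φ : C^∞⟮𝓡 n, M; 𝓘(ℝ, ℝ), ℝ⟯) ∘ γ) 0 :=
    hγ.isLocalMin_comp (-φ).contMDiff.continuous h.neg_symm_apply_le h0
  have h1 : deriv (φ ∘ γ) 0 = 0 := by
    have := hmax.neg.deriv_eq_zero
    simpa [comp_def] using this
  have h2 := (hδ.isLocalMin_comp φ.contMDiff.continuous h.apply_le h0').deriv_eq_zero
  rw [map_add, fderiv_velocity_eq_zero φ.contMDiff hγ.smooth h0 h1,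
    fderiv_velocity_eq_zero φ.contMDiff hδ.smooth h0' h2, add_zero,
    zero_apply]

theorem IsMorseSmale.exists_splittings {f : M ≃ₘ^∞⟮𝓡 n, 𝓡 n⟯ M} (hf : IsMorseSmale f) :
    ∃ P : M → EuclideanSpace ℝ (Fin n) →L[ℝ] EuclideanSpace ℝ (Fin n),
      ∀ p ∈ periodicPts f, IsHyperbolicSplitting (returnDeriv f p) (P p) := by
  choose! P hP using fun p hp => (hf.hyperbolic p hp).exists_splitting
  exact ⟨P, hP⟩

/-- This is minimality of `-φ` on the stable manifold of `f.symm`. -/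
theorem IsLyapunov.isMaxOn_unstableManifold {f : M ≃ₘ^∞⟮𝓡 n, 𝓡 n⟯ M}
    {φ : C^∞⟮𝓡 n, M; 𝓘(ℝ, ℝ), ℝ⟯} (h : IsLyapunov f φ) (p : M) :
    IsMaxOn φ (unstableManifold f p) p := by
  have := isMinOn_stableManifold (-φ).contMDiff.continuous h.neg_symm_apply_le p
  simpa using! this.neg

theorem IsStableCurve.apply_velocity_of_symm {f : M ≃ₘ^∞⟮𝓡 n, 𝓡 n⟯ M} {p : M}
    {P : EuclideanSpace ℝ (Fin n) →L[ℝ] EuclideanSpace ℝ (Fin n)}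
    (hP : IsHyperbolicSplitting (returnDeriv f p) P) {γ : ℝ → M} (hγ : IsStableCurve f.symm p γ)
    (hp : γ 0 = p) : P (velocity γ) = 0 := by
  have h := hγ.apply_velocity (hP.symm (returnDeriv_symm_mul f.symm p) (returnDeriv_symm_mul f p)) hp
  simpa using h

/-- Transversality at a periodic point `p` itself says that every stable vector is the velocity of a
curve in `W^s(p)` and every unstable vector the velocity of a curve in `W^u(p)`. -/
theorem IsMorseSmale.exists_stableCurve {f : M ≃ₘ^∞⟮𝓡 n, 𝓡 n⟯ M} (hf : IsMorseSmale f) {p : M}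
    (hp : p ∈ periodicPts f) {P : EuclideanSpace ℝ (Fin n) →L[ℝ] EuclideanSpace ℝ (Fin n)}
    (hP : IsHyperbolicSplitting (returnDeriv f p) P) (v : EuclideanSpace ℝ (Fin n)) :
    (∃ γ, IsStableCurve f p γ ∧ γ 0 = p ∧ velocity γ = P v) ∧
      ∃ γ, IsStableCurve f.symm p γ ∧ γ 0 = p ∧ velocity γ = v - P v := by
  obtain ⟨u, ⟨γ, hγ, h0, rfl⟩, v, ⟨δ, hδ, h0', rfl⟩, rfl⟩ := hf.transversal p hp p hp p
    ⟨mem_stableManifold_self f.symm p, mem_stableManifold_self f p⟩ v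
  have h1 := IsStableCurve.apply_velocity_of_symm hP hγ h0
  have h2 := hδ.apply_velocity hP h0'
  exact ⟨⟨δ, hδ, h0', by rw [map_add, h1, h2, zero_add]⟩,
    ⟨γ, hγ, h0, by rw [map_add, h1, h2, zero_add, add_sub_cancel_right]⟩⟩

/-- A Lyapunov function is a Morse-Lyapunov function if and only if its Hessian at the periodic
points is positive definite on the stable subspaces and negative definite on the unstable ones. -/
theorem IsLyapunov.isMorseLyapunov_iff [IsManifold (𝓡 n) ∞ M] {f : M ≃ₘ^∞⟮𝓡 n, 𝓡 n⟯ M}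
    (hf : IsMorseSmale f) {P : M → EuclideanSpace ℝ (Fin n) →L[ℝ] EuclideanSpace ℝ (Fin n)}
    (hP : ∀ p ∈ periodicPts f, IsHyperbolicSplitting (returnDeriv f p) (P p))
    {φ : C^∞⟮𝓡 n, M; 𝓘(ℝ, ℝ), ℝ⟯} (h : IsLyapunov f φ) :
    IsMorseLyapunov f φ ↔ ∀ p ∈ periodicPts f,
      (∀ v, P p v = v → v ≠ 0 → 0 < chartHessian φ p v v) ∧
      (∀ v, P p v = 0 → v ≠ 0 → chartHessian φ p v v < 0) := by
  have hess {p : M} (hp : p ∈ periodicPts f) {γ : ℝ → M}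
      (hγ : ContMDiff 𝓘(ℝ, ℝ) (𝓡 n) ∞ γ) (h0 : γ 0 = p) :=
    iteratedDeriv_two_comp_eq_chartHessian φ.contMDiff (h.mfderiv_eq_zero hf hp) hγ h0
  constructor
  · intro hφ p hp
    refine ⟨fun v hv hv0 => ?_, fun v hv hv0 => ?_⟩
    · obtain ⟨γ, hγ, h0, hγv⟩ := (hf.exists_stableCurve hp (hP p hp) v).1
      rw [hv] at hγv
      rw [← hγv, ← hess hp hγ.smooth h0]
      exact (hφ.nondegMin p hp).2 γ hγ h0 (hγv ▸ hv0)
    · obtain ⟨γ, hγ, h0, hγv⟩ := (hf.exists_stableCurve hp (hP p hp) v).2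
      rw [hv, sub_zero] at hγv
      rw [← hγv, ← hess hp hγ.smooth h0]
      exact (hφ.nondegMax p hp).2 γ hγ h0 (hγv ▸ hv0)
  · intro hφ
    refine ⟨h, fun p hp => ⟨?_, fun γ hγ h0 hv => ?_⟩, fun p hp => ⟨?_, fun γ hγ h0 hv => ?_⟩⟩
    · exact h.isMaxOn_unstableManifold p
    · rw [hess hp hγ.smooth h0]
      exact (hφ p hp).2 _ (IsStableCurve.apply_velocity_of_symm (hP p hp) hγ h0) hv
    · exact isMinOn_stableManifold φ.contMDiff.continuous h.apply_le p
    · rw [hess hp hγ.smooth h0]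
      exact (hφ p hp).1 _ (hγ.apply_velocity (hP p hp) h0) hv

end Lyapunov

/-! ### Definite forms -/

section PositiveDefinite

variable {E : Type*} [NormedAddCommGroup E] [NormedSpace ℝ E] [FiniteDimensional ℝ E]

/-- Definiteness on the kernel of a linear map is an open condition on bilinear forms; the sign of
`s` distinguishes positive from negative definite forms. -/
theorem isOpen_setOf_definite_on_ker (s : ℝ) (L : E →L[ℝ] E) :
    IsOpen {H : E →L[ℝ] E →L[ℝ] ℝ | ∀ v, L v = 0 → v ≠ 0 → 0 < s * H v v} := by
  have hK : IsCompact (Metric.sphere (0 : E) 1 ∩ {v | L v = 0}) :=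
    (isCompact_sphere 0 1).inter_right (isClosed_eq L.continuous continuous_const)
  have heq : {H : E →L[ℝ] E →L[ℝ] ℝ | ∀ v, L v = 0 → v ≠ 0 → 0 < s * H v v} =
      {H | ∀ v ∈ Metric.sphere (0 : E) 1 ∩ {v | L v = 0}, 0 < s * H v v} := by
    ext H
    constructor
    · rintro h v ⟨hv, hLv⟩
      exact h v hLv (ne_zero_of_mem_unit_sphere ⟨v, hv⟩)
    · intro h v hLv hv
      have := h (‖v‖⁻¹ • v) ⟨by simp [norm_smul, hv], by simp [hLv]⟩
      simp only [map_smul, smul_apply, smul_eq_mul] at this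
      have hv' : 0 < ‖v‖⁻¹ := by positivity
      rw [show s * (‖v‖⁻¹ * (‖v‖⁻¹ * H v v)) = ‖v‖⁻¹ * ‖v‖⁻¹ * (s * H v v) by ring] at this
      exact pos_of_mul_pos_right this (by positivity)
  rw [heq, isOpen_iff_eventually]
  intro H hH
  refine hK.eventually_forall_of_forall_eventually fun v hv => ?_
  have hc : Continuous fun z : (E →L[ℝ] E →L[ℝ] ℝ) × E => s * z.1 z.2 z.2 := by fun_prop
  exact hc.continuousAt.eventually_const_lt (hH v hv)

end PositiveDefinite

/-! ### The smooth topology -/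

section SmoothTopology

theorem contDiffOn_comp_symm {φ : M → ℝ} (hφ : ContMDiff (𝓡 n) 𝓘(ℝ, ℝ) ∞ φ)
    {e : OpenPartialHomeomorph M (EuclideanSpace ℝ (Fin n))}
    (he : e ∈ IsManifold.maximalAtlas (𝓡 n) ∞ M) : ContDiffOn ℝ ∞ (φ ∘ e.symm) e.target :=
  (hφ.comp_contMDiffOn (contMDiffOn_symm_of_mem_maximalAtlas he)).contDiffOn

theorem continuous_chartHessian [IsManifold (𝓡 n) ∞ M] (p : M) :
    Continuous fun φ : C^∞⟮𝓡 n, M; 𝓘(ℝ, ℝ), ℝ⟯ => chartHessian (n := n) φ p := by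
  have h1 : Continuous fun φ : C^∞⟮𝓡 n, M; 𝓘(ℝ, ℝ), ℝ⟯ =>
      iteratedFDeriv ℝ 2 (φ ∘ (extChartAt (𝓡 n) p).symm) (extChartAt (𝓡 n) p p) := by
    set e := chartAt (EuclideanSpace ℝ (Fin n)) p
    have hsub : ({e p} : Set (EuclideanSpace ℝ (Fin n))) ∈ {K | IsCompact K ∧ K ⊆ e.target} :=
      ⟨isCompact_singleton, singleton_subset_iff.2 (mem_chart_target _ p)⟩
    have h2 := (UniformOnFun.uniformContinuous_eval_of_mem
      (ContinuousMultilinearMap ℝ (fun _ : Fin 2 => EuclideanSpace ℝ (Fin n)) ℝ)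
      {K | IsCompact K ∧ K ⊆ e.target} (mem_singleton (e p)) hsub).continuous
    have h3 : Continuous fun φ : C^∞⟮𝓡 n, M; 𝓘(ℝ, ℝ), ℝ⟯ =>
        UniformOnFun.ofFun {K | IsCompact K ∧ K ⊆ e.target} (iteratedFDeriv ℝ 2 (φ ∘ e.symm)) :=
      continuous_iInf_dom (i := e) (continuous_iInf_dom
        (i := IsManifold.chart_mem_maximalAtlas p) (continuous_iInf_dom (i := 2)
          continuous_induced_dom))
    exact h2.comp h3
  refine continuous_clm_apply.2 fun v => continuous_clm_apply.2 fun w => ?_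
  have h3 : Continuous fun φ : C^∞⟮𝓡 n, M; 𝓘(ℝ, ℝ), ℝ⟯ =>
      iteratedFDeriv ℝ 2 (φ ∘ (extChartAt (𝓡 n) p).symm) (extChartAt (𝓡 n) p p) ![v, w] := by
    exact h1.eval_const ![v, w]
  simpa only [iteratedFDeriv_two_apply] using! h3

/-- The perturbations `φ + ε ψ` tend to `φ` in the `C^∞` topology. -/
theorem tendsto_add_smul (φ ψ : C^∞⟮𝓡 n, M; 𝓘(ℝ, ℝ), ℝ⟯) :
    Tendsto (fun ε : ℝ => φ + ε • ψ) (𝓝 0) (𝓝 φ) := by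
  simp only [nhds_iInf, tendsto_iInf, nhds_induced, tendsto_comap_iff]
  intro e he i
  rw [UniformOnFun.tendsto_iff_tendstoUniformlyOn]
  rintro K ⟨hK, hKe⟩
  have hψ := contDiffOn_comp_symm ψ.contMDiff he
  have hφ := contDiffOn_comp_symm φ.contMDiff he
  have hi : (i : WithTop ℕ∞) ≤ ∞ := by exact_mod_cast le_top
  have hcont : ContinuousOn (iteratedFDeriv ℝ i (ψ ∘ e.symm)) K :=
    ((hψ.continuousOn_iteratedFDerivWithin hi e.open_target.uniqueDiffOn).congr
      (fun y hy => (iteratedFDerivWithin_of_isOpen i e.open_target hy).symm)).mono hKe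
  obtain ⟨C, hC⟩ := hK.exists_bound_of_continuousOn hcont
  rw [Metric.tendstoUniformlyOn_iff]
  intro δ hδ
  have hsmall : ∀ᶠ ε : ℝ in 𝓝 0, |ε| * C < δ := by
    have : Tendsto (fun ε : ℝ => |ε| * C) (𝓝 0) (𝓝 (|0| * C)) := by
      exact (continuous_abs.mul continuous_const).tendsto 0
    exact this.eventually_lt_const (by simpa using hδ)
  filter_upwards [hsmall] with ε hε y hy
  have hφy : ContDiffAt ℝ i (φ ∘ e.symm) y :=
    (hφ.contDiffAt (e.open_target.mem_nhds (hKe hy))).of_le hi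
  have hψy : ContDiffAt ℝ i (ψ ∘ e.symm) y :=
    (hψ.contDiffAt (e.open_target.mem_nhds (hKe hy))).of_le hi
  have heq : iteratedFDeriv ℝ i ((φ + ε • ψ : C^∞⟮𝓡 n, M; 𝓘(ℝ, ℝ), ℝ⟯) ∘ e.symm) y =
      iteratedFDeriv ℝ i (φ ∘ e.symm) y + ε • iteratedFDeriv ℝ i (ψ ∘ e.symm) y := by
    rw [← iteratedFDeriv_const_smul_apply hψy]
    exact iteratedFDeriv_add_apply hφy (hψy.const_smul ε)
  simp only [comp_apply, UniformOnFun.toFun_ofFun]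
  rw [heq, dist_self_add_right, norm_smul, Real.norm_eq_abs]
  exact lt_of_le_of_lt (by gcongr; exact hC y hy) hε

end SmoothTopology

/-! ### Perturbations of Morse functions -/

section Morse

/-- Degenerate critical points are degenerate in every chart around them, not only in the preferred
one; in a fixed chart the first two derivatives depend continuously on the point. -/
theorem degenerate_in_chart [IsManifold (𝓡 n) ∞ M] {θ : M → ℝ}
    (hθ : ContMDiff (𝓡 n) 𝓘(ℝ, ℝ) ∞ θ) {x₀ x : M} (hx : x ∈ (extChartAt (𝓡 n) x₀).source)
    (hcrit : mfderiv (𝓡 n) 𝓘(ℝ, ℝ) θ x = 0) {v : EuclideanSpace ℝ (Fin n)}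
    (hv : ∀ w, chartHessian θ x v w = 0) (hv0 : v ≠ 0) :
    fderiv ℝ (θ ∘ (extChartAt (𝓡 n) x₀).symm) (extChartAt (𝓡 n) x₀ x) = 0 ∧
      ¬ Injective (fderiv ℝ (fderiv ℝ (θ ∘ (extChartAt (𝓡 n) x₀).symm))
        (extChartAt (𝓡 n) x₀ x)) := by
  set c := extChartAt (𝓡 n) x
  set c₀ := extChartAt (𝓡 n) x₀
  set τ := c ∘ c₀.symm
  set σ := c₀ ∘ c.symm
  set y := c₀ x
  have hy : y ∈ c₀.target := c₀.map_source hx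
  have hxy : c₀.symm y = x := c₀.left_inv hx
  have hxs : x ∈ c.source := mem_extChartAt_source x
  have hτy : τ y = c x := by simp only [τ, comp_apply, hxy]
  have hσ : σ (c x) = y := by simp only [σ, comp_apply, c.left_inv hxs]; rfl
  have hc₀symm : ContMDiffAt 𝓘(ℝ, EuclideanSpace ℝ (Fin n)) (𝓡 n) ∞ c₀.symm y :=
    (contMDiffOn_extChartAt_symm x₀).contMDiffAt ((isOpen_extChartAt_target x₀).mem_nhds hy)
  have hcsymm : ContMDiffAt 𝓘(ℝ, EuclideanSpace ℝ (Fin n)) (𝓡 n) ∞ c.symm (c x) :=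
    (contMDiffOn_extChartAt_symm x).contMDiffAt
      ((isOpen_extChartAt_target x).mem_nhds (mem_extChartAt_target x))
  have hτd : ContDiffAt ℝ ∞ τ y := by
    refine ContMDiffAt.contDiffAt (ContMDiffAt.comp y ?_ hc₀symm)
    rw [hxy]; exact contMDiffAt_extChartAt
  have hσd : ContDiffAt ℝ ∞ σ (c x) := by
    refine ContMDiffAt.contDiffAt (ContMDiffAt.comp (c x) ?_ hcsymm)
    rw [c.left_inv hxs]; exact contMDiffAt_extChartAt' (by rwa [← extChartAt_source (𝓡 n)])
  have hinv : τ ∘ σ =ᶠ[𝓝 (c x)] id := by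
    have h1 : ∀ᶠ z in 𝓝 (c x), c.symm z ∈ c₀.source :=
      hcsymm.continuousAt.eventually_mem
        ((isOpen_extChartAt_source x₀).mem_nhds (by rwa [c.left_inv hxs]))
    filter_upwards [h1, (isOpen_extChartAt_target x).mem_nhds (mem_extChartAt_target x)] with z hz hzt
    simp only [τ, σ, comp_apply, c₀.left_inv hz, id]
    exact c.right_inv hzt
  have hD (w) : fderiv ℝ τ y (fderiv ℝ σ (c x) w) = w := by
    have h1 := hinv.fderiv_eq (𝕜 := ℝ)
    rw [fderiv_comp _ (by rw [hσ]; exact hτd.differentiableAt (by simp))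
      (hσd.differentiableAt (by simp)), hσ, fderiv_id] at h1
    simpa using congrArg (fun L => L w) h1
  have heq : θ ∘ c₀.symm =ᶠ[𝓝 y] (θ ∘ c.symm) ∘ τ := by
    have h1 : ∀ᶠ z in 𝓝 y, c₀.symm z ∈ c.source :=
      hc₀symm.continuousAt.eventually_mem
        ((isOpen_extChartAt_source x).mem_nhds (by rwa [hxy]))
    filter_upwards [h1] with z hz
    simp only [τ, comp_apply, c.left_inv hz]
  have hu : ContDiffAt ℝ ∞ (θ ∘ c.symm) (τ y) := by
    rw [hτy]; exact contDiffAt_comp_extChartAt_symm hθ x (mem_extChartAt_target x)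
  have hu0 : fderiv ℝ (θ ∘ c.symm) (τ y) = 0 := by
    rw [hτy]; exact (mfderiv_eq_zero_iff_fderiv_chart hθ x).1 hcrit
  have h2 : (2 : WithTop ℕ∞) ≤ ∞ := by norm_cast
  constructor
  · rw [heq.fderiv_eq, fderiv_comp _ (hu.differentiableAt (by simp))
      (hτd.differentiableAt (by simp)), hu0, ContinuousLinearMap.zero_comp]
  · intro hinj
    have hw : fderiv ℝ σ (c x) v = 0 := by
      apply hinj
      rw [map_zero]
      ext w
      rw [heq.fderiv.fderiv_eq, fderiv_fderiv_comp_of_fderiv_eq_zero (hu.of_le h2) (hτd.of_le h2)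
        hu0, hD, hτy]
      exact hv _
    apply hv0
    rw [← hD v, hw, map_zero]

/-- On a compact manifold, small perturbations of a Morse function are Morse. -/
theorem IsMorse.eventually_add_smul [CompactSpace M] [IsManifold (𝓡 n) ∞ M]
    {φ : C^∞⟮𝓡 n, M; 𝓘(ℝ, ℝ), ℝ⟯} (hφ : IsMorse φ) (ψ : C^∞⟮𝓡 n, M; 𝓘(ℝ, ℝ), ℝ⟯) :
    ∀ᶠ ε : ℝ in 𝓝 0, IsMorse (φ + ε • ψ) := by
  have key : ∀ᶠ ε : ℝ in 𝓝 0, ∀ x ∈ (univ : Set M),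
      mfderiv (𝓡 n) 𝓘(ℝ, ℝ) (φ + ε • ψ : C^∞⟮𝓡 n, M; 𝓘(ℝ, ℝ), ℝ⟯) x = 0 →
      ∀ v : EuclideanSpace ℝ (Fin n), (∀ w, chartHessian (φ + ε • ψ : C^∞⟮𝓡 n, M; 𝓘(ℝ, ℝ), ℝ⟯)
        x v w = 0) → v = 0 := by
    refine isCompact_univ.eventually_forall_of_forall_eventually fun x₀ _ => ?_
    set c := extChartAt (𝓡 n) x₀
    have hdiff (θ : C^∞⟮𝓡 n, M; 𝓘(ℝ, ℝ), ℝ⟯) {y} (hy : y ∈ c.target) :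
        ContDiffAt ℝ ∞ (θ ∘ c.symm) y := contDiffAt_comp_extChartAt_symm θ.contMDiff x₀ hy
    have hx₀ : c x₀ ∈ c.target := mem_extChartAt_target x₀
    have hcont (θ : C^∞⟮𝓡 n, M; 𝓘(ℝ, ℝ), ℝ⟯) :
        ContDiffAt ℝ 1 (fderiv ℝ (θ ∘ c.symm)) (c x₀) :=
      (hdiff θ hx₀).fderiv_right (by norm_cast)
    have hcont₂ (θ : C^∞⟮𝓡 n, M; 𝓘(ℝ, ℝ), ℝ⟯) :
        ContinuousAt (fderiv ℝ (fderiv ℝ (θ ∘ c.symm))) (c x₀) :=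
      (hcont θ).continuousAt_fderiv (by simp)
    have hderiv (ε : ℝ) {y} (hy : y ∈ c.target) :
        fderiv ℝ ((φ + ε • ψ : C^∞⟮𝓡 n, M; 𝓘(ℝ, ℝ), ℝ⟯) ∘ c.symm) y =
          fderiv ℝ (φ ∘ c.symm) y + ε • fderiv ℝ (ψ ∘ c.symm) y := by
      have h1 := ((hdiff φ hy).differentiableAt (by simp)).hasFDerivAt
      have h2 := ((hdiff ψ hy).differentiableAt (by simp)).hasFDerivAt
      exact (h1.add (h2.const_smul ε)).fderiv
    have hderiv₂ (ε : ℝ) {y} (hy : y ∈ c.target) :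
        fderiv ℝ (fderiv ℝ ((φ + ε • ψ : C^∞⟮𝓡 n, M; 𝓘(ℝ, ℝ), ℝ⟯) ∘ c.symm)) y =
          fderiv ℝ (fderiv ℝ (φ ∘ c.symm)) y + ε • fderiv ℝ (fderiv ℝ (ψ ∘ c.symm)) y := by
      have heq : fderiv ℝ ((φ + ε • ψ : C^∞⟮𝓡 n, M; 𝓘(ℝ, ℝ), ℝ⟯) ∘ c.symm) =ᶠ[𝓝 y] fun z =>
          fderiv ℝ (φ ∘ c.symm) z + ε • fderiv ℝ (ψ ∘ c.symm) z := by
        filter_upwards [(isOpen_extChartAt_target x₀).mem_nhds hy] with z hz using hderiv ε hz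
      have hd (θ : C^∞⟮𝓡 n, M; 𝓘(ℝ, ℝ), ℝ⟯) : DifferentiableAt ℝ (fderiv ℝ (θ ∘ c.symm)) y :=
        ((hdiff θ hy).fderiv_right (m := 1) (by norm_cast)).differentiableAt (by simp)
      rw [heq.fderiv_eq]
      exact ((hd φ).hasFDerivAt.add ((hd ψ).hasFDerivAt.const_smul ε)).fderiv
    have hsnd : Tendsto (fun z : ℝ × M => c z.2) (𝓝 (0, x₀)) (𝓝 (c x₀)) :=
      (continuousAt_extChartAt x₀).tendsto.comp (continuous_snd.tendsto (0, x₀))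
    have hfst : Tendsto (fun z : ℝ × M => z.1) (𝓝 (0, x₀)) (𝓝 0) := continuous_fst.tendsto (0, x₀)
    have hlim₁ := ((hcont φ).continuousAt.tendsto.comp hsnd).add
      (hfst.smul ((hcont ψ).continuousAt.tendsto.comp hsnd))
    have hlim₂ := ((hcont₂ φ).tendsto.comp hsnd).add (hfst.smul ((hcont₂ ψ).tendsto.comp hsnd))
    rw [zero_smul, add_zero] at hlim₁ hlim₂
    have hsrc : ∀ᶠ z : ℝ × M in 𝓝 (0, x₀), z.2 ∈ c.source :=
      (continuous_snd.tendsto (0, x₀)).eventually_mem (extChartAt_source_mem_nhds x₀)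
    -- At `x₀` either the differential does not vanish or the Hessian is injective.
    by_cases hcrit : fderiv ℝ (φ ∘ c.symm) (c x₀) = 0
    · have hinj : Injective (fderiv ℝ (fderiv ℝ (φ ∘ c.symm)) (c x₀)) := by
        rw [injective_iff_map_eq_zero]
        intro v hv
        refine hφ x₀ ((mfderiv_eq_zero_iff_fderiv_chart φ.contMDiff x₀).2 hcrit) v fun w => ?_
        exact congrArg (fun L => L w) hv
      filter_upwards [hsrc, hlim₂.eventually_mem (ContinuousLinearMap.isOpen_injective.mem_nhds hinj)]
        with z hz hzinj hz0 v hv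
      by_contra hv0
      refine (degenerate_in_chart (ContMDiffMap.contMDiff _) hz hz0 hv hv0).2 ?_
      rw [hderiv₂ _ (c.map_source hz)]
      exact hzinj
    · filter_upwards [hsrc, hlim₁.eventually_ne hcrit] with z hz hzne hz0 v hv
      by_contra hv0
      refine hzne ?_
      have := (degenerate_in_chart (ContMDiffMap.contMDiff _) hz hz0 hv hv0).1
      rwa [hderiv _ (c.map_source hz)] at this
  filter_upwards [key] with ε hε x using hε x (mem_univ x)

end Morse

/-! ### Construction of the perturbation -/

section Construction

/-- Prescribed germs at finitely many points extend to a smooth function. -/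
theorem exists_contMDiff_eventuallyEq [T2Space M] [IsManifold (𝓡 n) ∞ M] {S : Set M}
    (hS : S.Finite) (q : M → M → ℝ)
    (hq : ∀ p, ContMDiffOn (𝓡 n) 𝓘(ℝ, ℝ) ∞ (q p)
      (chartAt (EuclideanSpace ℝ (Fin n)) p).source) :
    ∃ ψ : M → ℝ, ContMDiff (𝓡 n) 𝓘(ℝ, ℝ) ∞ ψ ∧ ∀ p ∈ S, ψ =ᶠ[𝓝 p] q p := by
  have hex (p : M) : ∃ χ : SmoothBumpFunction (𝓡 n) p, tsupport χ ⊆ (S \ {p})ᶜ := by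
    have hmem : (S \ {p})ᶜ ∈ 𝓝 p := by
      refine (hS.subset sdiff_subset).isClosed.isOpen_compl.mem_nhds ?_
      simp
    obtain ⟨χ, -, hχ⟩ := (SmoothBumpFunction.nhds_basis_tsupport (I := 𝓡 n) p).mem_iff.1 hmem
    exact ⟨χ, hχ⟩
  choose χ hχ using hex
  refine ⟨fun x => ∑ p ∈ hS.toFinset, χ p x • q p x,
    contMDiff_finsetSum fun p _ => (χ p).contMDiff_smul (hq p), fun p hp => ?_⟩
  have hone : ∀ᶠ x in 𝓝 p, χ p x = 1 := (χ p).eventuallyEq_one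
  have hzero : ∀ᶠ x in 𝓝 p, ∀ p' ∈ hS.toFinset, p' ≠ p → χ p' x = 0 := by
    rw [Filter.eventually_all_finset]
    intro p' _
    by_cases hne : p' = p
    · exact Eventually.of_forall fun x h => absurd hne h
    have hnot : p ∉ tsupport (χ p') := fun h => hχ p' h ⟨hp, fun h' => hne h'.symm⟩
    filter_upwards [(isClosed_tsupport _).isOpen_compl.mem_nhds hnot] with x hx _
    exact image_eq_zero_of_notMem_tsupport hx
  filter_upwards [hone, hzero] with x h1 h0
  rw [Finset.sum_eq_single_of_mem p (hS.mem_toFinset.2 hp), h1, one_smul]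
  intro p' hp' hne
  rw [h0 p' hp' hne, zero_smul]

theorem contMDiffOn_splitFunction [IsManifold (𝓡 n) ∞ M]
    (P : EuclideanSpace ℝ (Fin n) →L[ℝ] EuclideanSpace ℝ (Fin n)) (p : M) :
    ContMDiffOn (𝓡 n) 𝓘(ℝ, ℝ) ∞ (splitFunction P p)
      (chartAt (EuclideanSpace ℝ (Fin n)) p).source := by
  have h : ContDiff ℝ ∞ fun y : EuclideanSpace ℝ (Fin n) =>
      splitForm P (y - extChartAt (𝓡 n) p p) := by
    have h1 : ContDiff ℝ ∞ fun y : EuclideanSpace ℝ (Fin n) => y - extChartAt (𝓡 n) p p :=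
      contDiff_id.sub contDiff_const
    have h2 := P.contDiff.comp h1
    exact (h2.norm_sq ℝ).sub ((h1.sub h2).norm_sq ℝ)
  exact h.contMDiff.comp_contMDiffOn contMDiffOn_extChartAt

theorem iteratedDeriv_two_splitFunction_comp [IsManifold (𝓡 n) ∞ M]
    (P : EuclideanSpace ℝ (Fin n) →L[ℝ] EuclideanSpace ℝ (Fin n)) {γ : ℝ → M}
    (hγ : ContMDiff 𝓘(ℝ, ℝ) (𝓡 n) ∞ γ) {p : M} (hp : γ 0 = p) :
    iteratedDeriv 2 (splitFunction P p ∘ γ) 0 = 2 * splitForm P (velocity γ) := by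
  have h := iteratedDeriv_two_splitForm P
    ((contDiffAt_extChartAt_comp hγ hp).of_le (show (2 : WithTop ℕ∞) ≤ ∞ by norm_cast))
  rw [(hasDerivAt_extChartAt_velocity hγ hp).deriv, hp] at h
  exact h

/-- A common multiple `N` of the periods such that `f^N` contracts and expands by definite factors
at all periodic points. -/
theorem exists_iterate_splitFunction_le {f : M ≃ₘ^∞⟮𝓡 n, 𝓡 n⟯ M}
    (hfin : (periodicPts f).Finite)
    {P : M → EuclideanSpace ℝ (Fin n) →L[ℝ] EuclideanSpace ℝ (Fin n)}
    (hP : ∀ p ∈ periodicPts f, IsHyperbolicSplitting (returnDeriv f p) (P p)) :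
    ∃ N : ℕ, 1 ≤ N ∧ ∀ p ∈ periodicPts f, f^[N] p = p ∧
      ∀ᶠ x in 𝓝 p, splitFunction (P p) p (f^[N] x) ≤ splitFunction (P p) p x := by
  set L := ∏ p ∈ hfin.toFinset, minimalPeriod f p with hL
  have hLpos : 0 < L := Finset.prod_pos fun p hp =>
    minimalPeriod_pos_of_mem_periodicPts (hfin.mem_toFinset.1 hp)
  have hev : ∀ᶠ j : ℕ in atTop, ∀ p ∈ periodicPts f, ∀ i ≥ j, ∀ᶠ x in 𝓝 p,
      splitFunction (P p) p (f^[i * minimalPeriod f p] x) ≤ splitFunction (P p) p x :=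
    (Filter.eventually_all_finite hfin).2 fun p hp =>
      eventually_forall_ge_atTop.2 (eventually_iterate_splitFunction_le (hP p hp))
  obtain ⟨j, hj, hj1⟩ := (hev.and (eventually_ge_atTop 1)).exists
  refine ⟨j * L, Nat.mul_pos hj1 hLpos, fun p hp => ?_⟩
  obtain ⟨d, hd⟩ : minimalPeriod f p ∣ L :=
    Finset.dvd_prod_of_mem (fun p => minimalPeriod f p) (hfin.mem_toFinset.2 hp)
  have hd1 : 1 ≤ d := Nat.pos_of_ne_zero fun h => by simp [h] at hd; omega
  have hN : j * L = (j * d) * minimalPeriod f p := by rw [hd]; ring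
  rw [hN]
  exact ⟨(isPeriodicPt_minimalPeriod f p).const_mul _, hj p hp _ (by nlinarith)⟩

theorem iteratedDeriv_two_sum_comp [IsManifold (𝓡 n) ∞ M] {ψ₀ : M → ℝ}
    (hψ₀ : ContMDiff (𝓡 n) 𝓘(ℝ, ℝ) ∞ ψ₀) (f : M ≃ₘ^∞⟮𝓡 n, 𝓡 n⟯ M) (N : ℕ)
    {γ : ℝ → M} (hγ : ContMDiff 𝓘(ℝ, ℝ) (𝓡 n) ∞ γ) :
    iteratedDeriv 2 ((fun x => ∑ j ∈ Finset.range N, ψ₀ (f^[j] x)) ∘ γ) 0 =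
      ∑ j ∈ Finset.range N, iteratedDeriv 2 (ψ₀ ∘ (f^[j] ∘ γ)) 0 := by
  have h (j : ℕ) : ContDiffAt ℝ (2 : ℕ) (ψ₀ ∘ (f^[j] ∘ γ)) 0 :=
    ((hψ₀.comp ((contMDiff_iterate f j).comp hγ)).contMDiffAt.contDiffAt).of_le (by norm_cast)
  exact iteratedDeriv_fun_sum (n := 2) fun j _ => h j

/-- The function used to perturb Lyapunov functions: it vanishes at the periodic points, does not
increase along orbits near them, and is non-degenerate on their invariant manifolds. -/
theorem IsMorseSmale.exists_local_lyapunov [T2Space M] [IsManifold (𝓡 n) ∞ M]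
    {f : M ≃ₘ^∞⟮𝓡 n, 𝓡 n⟯ M} (hf : IsMorseSmale f) :
    ∃ ψ : C^∞⟮𝓡 n, M; 𝓘(ℝ, ℝ), ℝ⟯, (∀ p ∈ periodicPts f, ψ p = 0) ∧
      (∀ p ∈ periodicPts f, ∀ᶠ x in 𝓝 p, ψ (f x) ≤ ψ x) ∧
      (∀ p ∈ periodicPts f, ∀ γ : ℝ → M, IsStableCurve f p γ → γ 0 = p →
        velocity (n := n) γ ≠ 0 → 0 < iteratedDeriv 2 (ψ ∘ γ) 0) ∧
      (∀ p ∈ periodicPts f, ∀ γ : ℝ → M, IsStableCurve f.symm p γ → γ 0 = p →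
        velocity (n := n) γ ≠ 0 → iteratedDeriv 2 (ψ ∘ γ) 0 < 0) := by
  have hfin : (periodicPts f).Finite := hf.nonwandering_eq ▸ hf.finite
  obtain ⟨P, hP⟩ := hf.exists_splittings
  obtain ⟨N, hN1, hN⟩ := exists_iterate_splitFunction_le hfin hP
  obtain ⟨ψ₀, hψ₀, heq⟩ := exists_contMDiff_eventuallyEq hfin (fun p => splitFunction (P p) p)
    fun p => contMDiffOn_splitFunction (P p) p
  have hcurve {p : M} (hp : p ∈ periodicPts f) {γ : ℝ → M}
      (hγ : ContMDiff 𝓘(ℝ, ℝ) (𝓡 n) ∞ γ) (h0 : γ 0 = p) :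
      iteratedDeriv 2 (ψ₀ ∘ γ) 0 = 2 * splitForm (P p) (velocity γ) := by
    rw [← iteratedDeriv_two_splitFunction_comp (P p) hγ h0]
    refine Filter.EventuallyEq.iteratedDeriv_eq 2 ?_
    exact (hγ.continuous.tendsto' 0 p h0).eventually (heq p hp)
  refine ⟨⟨fun x => ∑ j ∈ Finset.range N, ψ₀ (f^[j] x),
    contMDiff_finsetSum fun j _ => hψ₀.comp (contMDiff_iterate f j)⟩, fun p hp => ?_,
    fun p hp => ?_, fun p hp γ hγ h0 hv => ?_, fun p hp γ hγ h0 hv => ?_⟩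
  · change ∑ j ∈ Finset.range N, ψ₀ (f^[j] p) = 0
    refine Finset.sum_eq_zero fun j _ => ?_
    rw [(heq _ (iterate_mem_periodicPts hp j)).eq_of_nhds, splitFunction_self]
  · -- The sum telescopes: `ψ (f x) - ψ x = ψ₀ (f^N x) - ψ₀ x`.
    have ht : Tendsto f^[N] (𝓝 p) (𝓝 p) :=
      (contMDiff_iterate f N).continuous.tendsto' p p (hN p hp).1
    filter_upwards [heq p hp, ht.eventually (heq p hp), (hN p hp).2] with x h1 h2 h3
    rw [← h1, ← h2] at h3
    have h4 := Finset.sum_range_succ' (fun j => ψ₀ (f^[j] x)) N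
    rw [Finset.sum_range_succ, iterate_zero, id] at h4
    change ∑ j ∈ Finset.range N, ψ₀ (f^[j] (f x)) ≤ ∑ j ∈ Finset.range N, ψ₀ (f^[j] x)
    simp only [iterate_succ, comp_apply] at h4
    linarith
  · refine lt_of_lt_of_eq ?_ (iteratedDeriv_two_sum_comp hψ₀ f N hγ.smooth).symm
    refine Finset.sum_pos (fun j _ => ?_) ⟨0, by simpa using Nat.pos_of_ne_zero (by omega)⟩
    obtain ⟨hj, hvj⟩ := hγ.iterate (f := f) (fun _ => rfl)
      (fun q hq => minimalPeriod_apply hq) hp hv j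
    have h0j : (f^[j] ∘ γ) 0 = f^[j] p := by rw [comp_apply, h0]
    have hpj := iterate_mem_periodicPts hp j
    rw [hcurve hpj hj.smooth h0j, splitForm, hj.apply_velocity (hP _ hpj) h0j]
    have := norm_pos_iff.2 hvj
    have h2 : 0 < ‖velocity (n := n) (f^[j] ∘ γ)‖ ^ 2 := by positivity
    simp only [sub_self, norm_zero]
    linarith
  · refine lt_of_eq_of_lt (iteratedDeriv_two_sum_comp hψ₀ f N hγ.smooth) ?_
    refine Finset.sum_neg (fun j _ => ?_) ⟨0, by simpa using Nat.pos_of_ne_zero (by omega)⟩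
    obtain ⟨hj, hvj⟩ := hγ.iterate (f := f) (commute_symm f)
      (fun q hq => by rw [minimalPeriod_symm, minimalPeriod_symm, minimalPeriod_apply hq]) hp hv j
    have h0j : (f^[j] ∘ γ) 0 = f^[j] p := by rw [comp_apply, h0]
    have hpj := iterate_mem_periodicPts hp j
    rw [hcurve hpj hj.smooth h0j, splitForm, IsStableCurve.apply_velocity_of_symm (hP _ hpj) hj h0j]
    have := norm_pos_iff.2 hvj
    have h2 : 0 < ‖velocity (n := n) (f^[j] ∘ γ)‖ ^ 2 := by positivity
    simp only [sub_zero, norm_zero]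
    linarith

end Construction

/-! ### Perturbations of Lyapunov functions -/

section Density

/-- Small perturbations by a function that does not increase along orbits near the periodic points
keep the Lyapunov property. -/
theorem IsLyapunov.eventually_add_smul [CompactSpace M] [IsManifold (𝓡 n) ∞ M]
    {f : M ≃ₘ^∞⟮𝓡 n, 𝓡 n⟯ M} {φ ψ : C^∞⟮𝓡 n, M; 𝓘(ℝ, ℝ), ℝ⟯} (hφ : IsLyapunov f φ)
    (hψ0 : ∀ p ∈ periodicPts f, ψ p = 0)
    (hψ : ∀ p ∈ periodicPts f, ∀ᶠ x in 𝓝 p, ψ (f x) ≤ ψ x) :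
    ∀ᶠ ε : ℝ in 𝓝[≥] 0, IsLyapunov f (φ + ε • ψ) := by
  have hφc : Continuous φ := φ.contMDiff.continuous
  have hψc : Continuous ψ := ψ.contMDiff.continuous
  have hdec : ∀ᶠ ε : ℝ in 𝓝 0, ∀ x ∈ (univ : Set M), 0 ≤ ε → x ∉ periodicPts f →
      φ (f x) + ε * ψ (f x) < φ x + ε * ψ x := by
    refine isCompact_univ.eventually_forall_of_forall_eventually fun x₀ _ => ?_
    by_cases hx₀ : x₀ ∈ periodicPts f
    · filter_upwards [(continuous_snd.tendsto ((0 : ℝ), x₀)).eventually (hψ x₀ hx₀)]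
        with z hz hz0 hzp
      exact add_lt_add_of_lt_of_le (hφ.decreasing _ hzp) (mul_le_mul_of_nonneg_left hz hz0)
    · have h1 : Continuous fun z : ℝ × M => φ (f z.2) + z.1 * ψ (f z.2) :=
        (hφc.comp (f.continuous.comp continuous_snd)).add
          (continuous_fst.mul (hψc.comp (f.continuous.comp continuous_snd)))
      have h2 : Continuous fun z : ℝ × M => φ z.2 + z.1 * ψ z.2 :=
        (hφc.comp continuous_snd).add (continuous_fst.mul (hψc.comp continuous_snd))
      have h3 := h1.continuousAt.eventually_lt h2.continuousAt (x₀ := ((0 : ℝ), x₀))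
        (by simpa using hφ.decreasing x₀ hx₀)
      filter_upwards [h3] with z hz _ _ using hz
  filter_upwards [nhdsWithin_le_nhds hdec, nhdsWithin_le_nhds (hφ.morse.eventually_add_smul ψ),
    self_mem_nhdsWithin] with ε h1 h2 h3
  refine ⟨h2, fun x hx => h1 x (mem_univ x) h3 hx, fun x hx => ?_⟩
  have hfx : f x ∈ periodicPts f := iterate_mem_periodicPts hx 1
  change φ (f x) + ε * ψ (f x) = φ x + ε * ψ x
  rw [hφ.const x hx, hψ0 x hx, hψ0 _ hfx]

theorem iteratedDeriv_two_add_smul_comp [IsManifold (𝓡 n) ∞ M]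
    (φ ψ : C^∞⟮𝓡 n, M; 𝓘(ℝ, ℝ), ℝ⟯) (ε : ℝ) {γ : ℝ → M} (hγ : ContMDiff 𝓘(ℝ, ℝ) (𝓡 n) ∞ γ) :
    iteratedDeriv 2 ((φ + ε • ψ : C^∞⟮𝓡 n, M; 𝓘(ℝ, ℝ), ℝ⟯) ∘ γ) 0 =
      iteratedDeriv 2 (φ ∘ γ) 0 + ε * iteratedDeriv 2 (ψ ∘ γ) 0 := by
  have h (θ : C^∞⟮𝓡 n, M; 𝓘(ℝ, ℝ), ℝ⟯) : ContDiffAt ℝ (2 : ℕ) (θ ∘ γ) 0 :=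
    ((θ.contMDiff.comp hγ).contMDiffAt.contDiffAt).of_le (by norm_cast)
  have h1 := iteratedDeriv_fun_add (n := 2) (h φ) ((h ψ).const_smul ε)
  refine h1.trans ?_
  congr 1
  exact iteratedDeriv_const_smul_field (n := 2) ε (ψ ∘ γ) ▸ rfl

end Density

/-! ### Openness and density -/

theorem dense_morseLyapunovFunctions {n : ℕ} {M : Type*} [TopologicalSpace M] [T2Space M]
    [CompactSpace M] [ChartedSpace (EuclideanSpace ℝ (Fin n)) M] [IsManifold (𝓡 n) ∞ M]
    (f : M ≃ₘ^∞⟮𝓡 n, 𝓡 n⟯ M) (hf : MorseLyapunov.IsMorseSmale f) :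
    Dense (morseLyapunovFunctions f) := by
  obtain ⟨ψ, hψ0, hψ, hs, hu⟩ := hf.exists_local_lyapunov
  rintro ⟨φ, hφ⟩
  rw [closure_subtype]
  have hlim : Tendsto (fun ε : ℝ => φ + ε • ψ) (𝓝[>] 0) (𝓝 φ) :=
    (tendsto_add_smul φ ψ).mono_left nhdsWithin_le_nhds
  refine mem_closure_of_tendsto hlim ?_
  have hl := (hφ.eventually_add_smul hψ0 hψ).filter_mono (nhdsWithin_mono 0 Ioi_subset_Ici_self)
  filter_upwards [hl, self_mem_nhdsWithin] with ε hε hpos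
  refine ⟨⟨_, hε⟩, ⟨hε, fun p hp => ⟨?_, fun γ hγ h0 hv => ?_⟩,
    fun p hp => ⟨?_, fun γ hγ h0 hv => ?_⟩⟩, rfl⟩
  · exact hε.isMaxOn_unstableManifold p
  · rw [iteratedDeriv_two_add_smul_comp _ _ _ hγ.smooth]
    have h1 := hγ.iteratedDeriv_two_nonneg (-φ).contMDiff.continuous hφ.neg_symm_apply_le h0
    have h2 : iteratedDeriv 2 ((-φ : C^∞⟮𝓡 n, M; 𝓘(ℝ, ℝ), ℝ⟯) ∘ γ) 0 =
      - iteratedDeriv 2 (φ ∘ γ) 0 := iteratedDeriv_fun_neg 2 (φ ∘ γ) 0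
    rw [h2] at h1
    have h3 := mul_neg_of_pos_of_neg hpos (hu p hp γ hγ h0 hv)
    linarith
  · exact isMinOn_stableManifold (ContMDiffMap.contMDiff _).continuous hε.apply_le p
  · rw [iteratedDeriv_two_add_smul_comp _ _ _ hγ.smooth]
    have h1 := hγ.iteratedDeriv_two_nonneg φ.contMDiff.continuous hφ.apply_le h0
    have h3 := mul_pos hpos (hs p hp γ hγ h0 hv)
    linarith

theorem isOpen_morseLyapunovFunctions {n : ℕ} {M : Type*} [TopologicalSpace M]
    [ChartedSpace (EuclideanSpace ℝ (Fin n)) M] [IsManifold (𝓡 n) ∞ M]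
    (f : M ≃ₘ^∞⟮𝓡 n, 𝓡 n⟯ M) (hf : MorseLyapunov.IsMorseSmale f) :
    IsOpen (morseLyapunovFunctions f) := by
  have hfin : (periodicPts f).Finite := hf.nonwandering_eq ▸ hf.finite
  obtain ⟨P, hP⟩ := hf.exists_splittings
  have heq : morseLyapunovFunctions f = ⋂ p ∈ periodicPts f,
      (fun φ : LyapunovFunction f => chartHessian (n := n) φ.1 p) ⁻¹'
        ({H | ∀ v, (P p - 1) v = 0 → v ≠ 0 → 0 < 1 * H v v} ∩
          {H | ∀ v, P p v = 0 → v ≠ 0 → 0 < -1 * H v v}) := by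
    ext φ
    simp only [mem_iInter, mem_preimage, mem_inter_iff, mem_ofPred_eq, sub_apply,
      one_apply_eq_self, sub_eq_zero, one_mul, neg_one_mul, neg_pos]
    exact φ.2.isMorseLyapunov_iff hf hP
  rw [heq]
  refine hfin.isOpen_biInter fun p _ => IsOpen.preimage ?_ ?_
  · exact (continuous_chartHessian p).comp continuous_subtype_val
  · exact (isOpen_setOf_definite_on_ker 1 _).inter (isOpen_setOf_definite_on_ker (-1) _)

end MorseLyapunov

theorem theorem1p1 {n : ℕ} {M : Type*} [TopologicalSpace M] [T2Space M] [CompactSpace M]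
    [ChartedSpace (EuclideanSpace ℝ (Fin n)) M] [IsManifold (𝓡 n) ∞ M]
    (f : M ≃ₘ^∞⟮𝓡 n, 𝓡 n⟯ M) (hf : MorseLyapunov.IsMorseSmale f) :
    IsOpen (MorseLyapunov.morseLyapunovFunctions f) ∧
      Dense (MorseLyapunov.morseLyapunovFunctions f) ∧
      MorseLyapunov.morseLyapunovFunctions f ∈ residual (MorseLyapunov.LyapunovFunction f) :=
  ⟨MorseLyapunov.isOpen_morseLyapunovFunctions f hf, MorseLyapunov.dense_morseLyapunovFunctions f hf,
    residual_of_dense_open (MorseLyapunov.isOpen_morseLyapunovFunctions f hf)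
      (MorseLyapunov.dense_morseLyapunovFunctions f hf)⟩
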